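/- A convex body in the Euclidean plane is a nonempty, compact, convex subset of $\mathbb{R}^2$. Let $\mathcal{K}^2$ be the space of all convex bodies in the plane, equipped with the Hausdorff metric. A point $z \in \mathbb{R}^2$ is called a convexity point of $K \in \mathcal{K}^2$ if $(K - z) \cup (z - K)$ is convex; equivalently, if the union of $K$ and its reflection in $z$ is convex. Then a typical convex body in the plane has infinitely many convexity points; that is, the set of all $K \in \mathcal{K}^2$ that have infinitely many convexity points is comeager (residual) in $\mathcal{K}^2$: its complement is a countable union of nowhere dense subsets of $\mathcal{K}^2$. -/

import Mathlib

open scoped Pointwise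

/-- The point `z` is a convexity point of the convex body `K` in the Euclidean plane if
`(K - z) ∪ (z - K)` is convex, that is, if the union of `K` and its reflection in `z` is convex. -/
def IsConvexityPoint (K : ConvexBody (EuclideanSpace ℝ (Fin 2))) (z : EuclideanSpace ℝ (Fin 2)) :
    Prop :=
  Convex ℝ (((K : Set (EuclideanSpace ℝ (Fin 2))) - {z}) ∪ ({z} - (K : Set (EuclideanSpace ℝ (Fin 2)))))

open Filter Topology Set Metric

/-! The points of `antipodalSum K u`, for `u ≠ 0`, are twice the midpoints of boundary points of `K`
with opposite outer normals. The point `z` is a convexity point once `2z` lies in `antipodalSum K u`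
for every `u ≠ 0` with `h(u) - h(-u) = ⟨2z, u⟩`, where `h` is the support function: then `K - z` and
`z - K` have intersecting faces whenever their supporting lines coincide
(`isConvexityPoint_of_faces`).

A strictly exposed point `y` of the union of all antipodal sums has this property
(`mem_antipodalSum_of_strictly_maximal`). Indeed `h(w) - h(-w) - ⟨y, w⟩` is monotone along a line of
directions parallel to the exposing vector, and a zero at a direction whose antipodal sum misses `y`
would be a strict crossing, leaving no room for the direction that does realise `y`. A point
farthest from some centre `c` is strictly exposed, so a region that contains every farthest point
yields a convexity point.

The rest is a Baire argument. `manyFarthest n` asks for `n` disjoint open regions, each containing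
all sums farthest from its own centre, with a margin. It is open by upper semicontinuity of faces.
It is dense: approximate by a polygon in general position, where the sum `y` farthest from `c` is
attained on an open set of directions, then add a small multiple of a disc with spikes. Suitable
spike lengths split `y` into many sums at one common maximal distance from `c`, and
`mem_manyFarthest` separates these. A body in every `manyFarthest (n + 1)` has infinitely many
convexity points. -/

/-- The support function of a convex body. -/
noncomputable def supportFun {V : Type*} [NormedAddCommGroup V] [InnerProductSpace ℝ V]
    (K : ConvexBody V) (u : V) : ℝ :=
  sSup ((fun x => inner ℝ x u) '' (K : Set V))

/-- The face of a convex body with outer normal vector `u`. -/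
def face {V : Type*} [NormedAddCommGroup V] [InnerProductSpace ℝ V]
    (K : ConvexBody V) (u : V) : Set V :=
  {x | x ∈ K ∧ ∀ y ∈ K, inner ℝ y u ≤ inner ℝ x u}

/-! ### Support functions and faces: continuity and semicontinuity. -/

section Basics

variable {V : Type*} [NormedAddCommGroup V] [InnerProductSpace ℝ V]

theorem inner_le_supportFun {K : ConvexBody V} {x : V} (hx : x ∈ K) (u : V) :
    inner ℝ x u ≤ supportFun K u := by
  refine le_csSup ?_ (mem_image_of_mem _ hx)
  exact (K.isCompact.image (by fun_prop)).bddAbove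

theorem face_nonempty (K : ConvexBody V) (u : V) : (face K u).Nonempty := by
  obtain ⟨x, hx, hmax⟩ := K.isCompact.exists_isMaxOn K.nonempty
    (f := fun x => inner ℝ x u) (by fun_prop)
  exact ⟨x, hx, fun y hy => hmax hy⟩

theorem inner_eq_supportFun {K : ConvexBody V} {x u : V} (hx : x ∈ face K u) :
    inner ℝ x u = supportFun K u := by
  refine le_antisymm (inner_le_supportFun hx.1 u) (csSup_le (K.nonempty.image _) ?_)
  rintro _ ⟨y, hy, rfl⟩
  exact hx.2 y hy

theorem mem_face_iff {K : ConvexBody V} {x u : V} :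
    x ∈ face K u ↔ x ∈ K ∧ supportFun K u ≤ inner ℝ x u := by
  refine ⟨fun h => ⟨h.1, (inner_eq_supportFun h).ge⟩, fun h => ⟨h.1, fun y hy => ?_⟩⟩
  exact (inner_le_supportFun hy u).trans h.2

theorem face_smul (K : ConvexBody V) (u : V) {t : ℝ} (ht : 0 < t) : face K (t • u) = face K u := by
  ext x
  simp [face, inner_smul_right, mul_le_mul_iff_right₀ ht]

theorem supportFun_smul (K : ConvexBody V) (u : V) {t : ℝ} (ht : 0 < t) :
    supportFun K (t • u) = t * supportFun K u := by
  obtain ⟨x, hx⟩ := face_nonempty K u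
  rw [← inner_eq_supportFun hx, ← inner_eq_supportFun (K := K) (u := t • u) (x := x)
    (by rwa [face_smul K u ht]), inner_smul_right]

theorem exists_mem_dist_le (K L : ConvexBody V) {x : V} (hx : x ∈ K) :
    ∃ y ∈ L, dist x y ≤ dist K L := by
  obtain ⟨y, hy, h⟩ := L.isCompact.exists_infDist_eq_dist L.nonempty x
  refine ⟨y, hy, h ▸ ?_⟩
  exact infDist_le_hausdorffDist_of_mem hx ConvexBody.hausdorffEDist_ne_top

theorem supportFun_le_add (K L : ConvexBody V) (u w : V) {M : ℝ} (hM : ∀ y ∈ L, ‖y‖ ≤ M) :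
    supportFun K u ≤ supportFun L w + (dist K L * ‖u‖ + M * ‖u - w‖) := by
  obtain ⟨x, hx⟩ := face_nonempty K u
  obtain ⟨y, hy, hxy⟩ := exists_mem_dist_le K L hx.1
  rw [← inner_eq_supportFun hx]
  have h1 : inner ℝ x u = inner ℝ (x - y) u + inner ℝ y (u - w) + inner ℝ y w := by
    rw [inner_sub_left, inner_sub_right]; ring
  have h2 := (real_inner_le_norm (x - y) u).trans
    (mul_le_mul_of_nonneg_right (dist_eq_norm x y ▸ hxy) (norm_nonneg u))
  have h3 := (real_inner_le_norm y (u - w)).trans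
    (mul_le_mul_of_nonneg_right (hM y hy) (norm_nonneg _))
  linarith [inner_le_supportFun hy w]

theorem exists_forall_dist_lt_one_norm_le (K : ConvexBody V) :
    ∃ M, 0 ≤ M ∧ ∀ L : ConvexBody V, dist L K < 1 → ∀ y ∈ L, ‖y‖ ≤ M := by
  obtain ⟨C, hC0, hC⟩ := K.isBounded.exists_pos_norm_le
  refine ⟨C + 1, by positivity, fun L hL y hy => ?_⟩
  obtain ⟨x, hx, hxy⟩ := exists_mem_dist_le L K hy
  have := norm_le_norm_add_norm_sub' y x
  rw [← dist_eq_norm] at this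
  linarith [hC x hx]

theorem continuous_supportFun :
    Continuous fun p : ConvexBody V × V => supportFun p.1 p.2 := by
  rw [continuous_iff_continuousAt]
  rintro ⟨K, u⟩
  obtain ⟨M, hM0, hM⟩ := exists_forall_dist_lt_one_norm_le K
  rw [ContinuousAt, tendsto_iff_dist_tendsto_zero]
  have hb : Tendsto (fun p : ConvexBody V × V => dist p.1 K * (‖p.2‖ + ‖u‖) + M * ‖p.2 - u‖)
      (𝓝 (K, u)) (𝓝 0) := by
    have : Continuous fun p : ConvexBody V × V =>
      dist p.1 K * (‖p.2‖ + ‖u‖) + M * ‖p.2 - u‖ := by fun_prop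
    simpa using this.tendsto (K, u)
  refine squeeze_zero' (Eventually.of_forall fun _ => dist_nonneg) ?_ hb
  have hnear : ∀ᶠ p : ConvexBody V × V in 𝓝 (K, u), dist p.1 K < 1 :=
    continuous_fst.tendsto (K, u) |>.eventually (ball_mem_nhds K one_pos)
  filter_upwards [hnear] with p hp
  have h1 := supportFun_le_add p.1 K p.2 u (hM K (by simp))
  have h2 := supportFun_le_add K p.1 u p.2 (hM p.1 hp)
  rw [dist_comm K p.1, norm_sub_rev u] at h2
  have := mul_nonneg (dist_nonneg (x := p.1) (y := K)) (norm_nonneg u)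
  have := mul_nonneg (dist_nonneg (x := p.1) (y := K)) (norm_nonneg p.2)
  rw [Real.dist_eq, abs_le]
  constructor <;> nlinarith

theorem continuous_supportFun_right (K : ConvexBody V) : Continuous (supportFun K) :=
  continuous_supportFun.comp (Continuous.prodMk_right K)

theorem isClosed_setOf_mem : IsClosed {p : ConvexBody V × V | p.2 ∈ p.1} := by
  rw [← isOpen_compl_iff, Metric.isOpen_iff]
  rintro ⟨K, x⟩ hx
  have hpos : 0 < infDist x (K : Set V) := (K.isClosed.notMem_iff_infDist_pos K.nonempty).1 hx
  refine ⟨infDist x (K : Set V) / 2, by positivity, ?_⟩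
  rintro ⟨L, y⟩ hLy hy
  rw [mem_ball, Prod.dist_eq, max_lt_iff] at hLy
  obtain ⟨w, hw, hyw⟩ := exists_mem_dist_le L K (show y ∈ L from hy)
  have := infDist_le_dist_of_mem (x := x) hw
  have := dist_triangle_left x w y
  simp only at hLy
  linarith

theorem isClosed_setOf_mem_face :
    IsClosed {p : ConvexBody V × V × V | p.2.2 ∈ face p.1 p.2.1} := by
  simp only [mem_face_iff, ofPred_and]
  refine (isClosed_setOf_mem.preimage (f := fun p : ConvexBody V × V × V => (p.1, p.2.2))
    (by fun_prop)).inter (isClosed_le ?_ (by fun_prop))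
  exact continuous_supportFun.comp (f := fun p : ConvexBody V × V × V => (p.1, p.2.1))
    (by fun_prop)

/-- Upper semicontinuity of faces: their graph is closed, and nearby bodies stay in one compact
ball, so the tube lemma applies. -/
theorem eventually_face_subset [FiniteDimensional ℝ V] (K : ConvexBody V) (u : V) {O : Set V}
    (hO : IsOpen O) (hKO : face K u ⊆ O) :
    ∀ᶠ p : ConvexBody V × V in 𝓝 (K, u), face p.1 p.2 ⊆ O := by
  obtain ⟨M, -, hM⟩ := exists_forall_dist_lt_one_norm_le K
  have hcpt : IsCompact (closedBall (0 : V) M) := isCompact_closedBall _ _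
  have hev := hcpt.eventually_forall_of_forall_eventually (x₀ := (K, u))
    (P := fun p x => x ∈ face p.1 p.2 → x ∈ O) (fun x _ => by
      have hop : IsOpen {q : (ConvexBody V × V) × V | q.2 ∈ face q.1.1 q.1.2 → q.2 ∈ O} := by
        simp only [imp_iff_not_or, ofPred_or]
        refine IsOpen.union ?_ (hO.preimage continuous_snd)
        exact (isClosed_setOf_mem_face.preimage
          (f := fun q : (ConvexBody V × V) × V => (q.1.1, q.1.2, q.2)) (by fun_prop)).isOpen_compl
      exact hop.mem_nhds fun h => hKO h)
  have hnear : ∀ᶠ p : ConvexBody V × V in 𝓝 (K, u), dist p.1 K < 1 :=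
    continuous_fst.tendsto (K, u) |>.eventually (ball_mem_nhds K one_pos)
  filter_upwards [hev, hnear] with p hp h1 x hx
  exact hp x (by simpa using hM p.1 h1 x hx.1) hx

theorem mem_of_forall_inner_le [CompleteSpace V] {K : ConvexBody V} {x : V}
    (h : ∀ u, inner ℝ x u ≤ supportFun K u) : x ∈ K := by
  by_contra hx
  obtain ⟨f, s, hf, hs⟩ := geometric_hahn_banach_closed_point K.convex K.isClosed hx
  set u := (InnerProductSpace.toDual ℝ V).symm f
  have hu : ∀ y, f y = inner ℝ y u := fun y => by
    rw [real_inner_comm, InnerProductSpace.toDual_symm_apply]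
  obtain ⟨y, hy⟩ := face_nonempty K u
  have := hf y hy.1
  rw [hu, inner_eq_supportFun hy] at this
  rw [hu] at hs
  linarith [h u]

theorem exists_supportFun_lt [CompleteSpace V] {K : ConvexBody V} {x : V} (hx : x ∉ K) :
    ∃ u, supportFun K u < inner ℝ x u := by
  by_contra! h
  exact hx (mem_of_forall_inner_le h)

/-- The points strictly below level `M`, together with the hull of the points of `S` at level `M`,
form a convex set containing `S`. -/
theorem mem_convexHull_inter_of_inner_eq {S : Set V} {u : V} {M : ℝ}
    (hS : ∀ s ∈ S, inner ℝ s u ≤ M) {x : V} (hx : x ∈ convexHull ℝ S) (hM : M ≤ inner ℝ x u) :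
    x ∈ convexHull ℝ (S ∩ {s | inner ℝ s u = M}) := by
  set H := convexHull ℝ (S ∩ {s | inner ℝ s u = M})
  have hlin : ∀ (a b : ℝ) (y z : V), inner ℝ (a • y + b • z) u = a * inner ℝ y u + b * inner ℝ z u :=
    fun a b y z => by simp [inner_add_left, inner_smul_left]
  have hH : ∀ y ∈ H, inner ℝ y u = M := by
    intro y hy
    refine convexHull_min (t := {s | inner ℝ s u = M}) inter_subset_right ?_ hy
    intro a ha b hb p q _ _ hpq
    simp only [mem_ofPred_eq] at ha hb ⊢
    rw [hlin, ha, hb, ← add_mul, hpq, one_mul]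
  have hT : Convex ℝ {y | inner ℝ y u < M ∨ y ∈ H} := by
    intro a ha b hb p q hp hq hpq
    have hle : ∀ y, (inner ℝ y u < M ∨ y ∈ H) → inner ℝ y u ≤ M := fun y hy =>
      hy.elim le_of_lt fun h => (hH y h).le
    rcases hp.eq_or_lt with rfl | hp'
    · obtain rfl : q = 1 := by linarith
      simpa using hb
    rcases hq.eq_or_lt with rfl | hq'
    · obtain rfl : p = 1 := by linarith
      simpa using ha
    by_cases hab : a ∈ H ∧ b ∈ H
    · exact Or.inr (convex_convexHull ℝ _ hab.1 hab.2 hp hq hpq)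
    left
    rw [hlin]
    have ha' := hle a ha
    have hb' := hle b hb
    have hM : M = p * M + q * M := by rw [← add_mul, hpq, one_mul]
    rw [hM]
    rcases not_and_or.1 hab with h | h
    · have : inner ℝ a u < M := ha.resolve_right h
      nlinarith
    · have : inner ℝ b u < M := hb.resolve_right h
      nlinarith
  have hsub : S ⊆ {y | inner ℝ y u < M ∨ y ∈ H} := fun s hs =>
    (hS s hs).lt_or_eq.imp id fun h => subset_convexHull ℝ _ ⟨hs, h⟩
  exact (convexHull_min hsub hT hx).resolve_left (not_lt.2 hM)

end Basics

/-! ### Plane geometry and a criterion for convex unions. -/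

theorem IsCompact.convexHull_union {V : Type*} [NormedAddCommGroup V] [NormedSpace ℝ V]
    {A B : Set V} (hA : IsCompact A) (hB : IsCompact B) (hAc : Convex ℝ A) (hBc : Convex ℝ B)
    (hA0 : A.Nonempty) (hB0 : B.Nonempty) : IsCompact (convexHull ℝ (A ∪ B)) := by
  have : convexHull ℝ (A ∪ B) =
      (fun p : ℝ × V × V => (1 - p.1) • p.2.1 + p.1 • p.2.2) '' (Icc (0 : ℝ) 1 ×ˢ A ×ˢ B) := by
    rw [hAc.convexHull_union hBc hA0 hB0]
    ext x
    simp only [mem_convexJoin, segment_eq_image, mem_image, mem_prod, Prod.exists]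
    constructor
    · rintro ⟨a, ha, b, hb, t, ht, rfl⟩
      exact ⟨t, a, b, ⟨ht, ha, hb⟩, rfl⟩
    · rintro ⟨t, a, b, ⟨ht, ha, hb⟩, rfl⟩
      exact ⟨a, ha, b, hb, t, ht, rfl⟩
  rw [this]
  exact (isCompact_Icc.prod (hA.prod hB)).image (by fun_prop)

/-- The convex hull of the union of two convex bodies. -/
noncomputable def hullUnion {V : Type*} [NormedAddCommGroup V] [InnerProductSpace ℝ V]
    (A B : ConvexBody V) : ConvexBody V where
  carrier := convexHull ℝ ((A : Set V) ∪ B)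
  convex' := convex_convexHull ℝ _
  isCompact' := A.isCompact.convexHull_union B.isCompact A.convex B.convex A.nonempty B.nonempty
  nonempty' := (A.nonempty.mono subset_union_left).convexHull

theorem mem_hullUnion {V : Type*} [NormedAddCommGroup V] [InnerProductSpace ℝ V]
    {A B : ConvexBody V} {x : V} : x ∈ hullUnion A B ↔ x ∈ convexHull ℝ ((A : Set V) ∪ B) :=
  Iff.rfl

/-- The Euclidean plane. -/
abbrev Plane := EuclideanSpace ℝ (Fin 2)

/-- Rotation of the plane by a right angle. -/
noncomputable def rot (x : Plane) : Plane := !₂[-x 1, x 0]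

section Plane

theorem inner_plane (x y : Plane) : inner ℝ x y = x 0 * y 0 + x 1 * y 1 := by
  simp [PiLp.inner_apply, Fin.sum_univ_two, mul_comm]

theorem norm_sq_plane (x : Plane) : ‖x‖ ^ 2 = x 0 ^ 2 + x 1 ^ 2 := by
  rw [← real_inner_self_eq_norm_sq, inner_plane]; ring

@[simp] theorem rot_apply_zero (x : Plane) : rot x 0 = -x 1 := rfl

@[simp] theorem rot_apply_one (x : Plane) : rot x 1 = x 0 := rfl

theorem inner_rot_self (x : Plane) : inner ℝ (rot x) x = 0 := by
  rw [inner_plane]; simp; ring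

theorem norm_rot (x : Plane) : ‖rot x‖ = ‖x‖ := by
  have : ‖rot x‖ ^ 2 = ‖x‖ ^ 2 := by rw [norm_sq_plane, norm_sq_plane]; simp; ring
  exact (pow_left_inj₀ (norm_nonneg _) (norm_nonneg _) two_ne_zero).1 this

theorem rot_ne_zero {x : Plane} (hx : x ≠ 0) : rot x ≠ 0 := by
  rwa [← norm_ne_zero_iff, norm_rot, norm_ne_zero_iff]

theorem rot_sub (x y : Plane) : rot (x - y) = rot x - rot y := by
  ext i
  fin_cases i
  · simp; ring
  · simp

theorem continuous_rot : Continuous rot := by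
  unfold rot
  refine (PiLp.continuous_toLp 2 _).comp (continuous_pi fun i => ?_)
  fin_cases i <;> simp <;> fun_prop

theorem plane_decomp {v : Plane} (hv : v ≠ 0) (x : Plane) :
    x = (inner ℝ x (rot v) / ‖v‖ ^ 2) • rot v + (inner ℝ x v / ‖v‖ ^ 2) • v := by
  have h : ‖v‖ ^ 2 ≠ 0 := by positivity
  have h' := norm_sq_plane v
  ext i
  fin_cases i <;> simp [inner_plane] <;> field_simp <;> rw [h'] <;> ring

theorem exists_eq_smul_rot_of_inner_eq_zero {x u : Plane} (hu : u ≠ 0) (h : inner ℝ x u = 0) :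
    ∃ t : ℝ, x = t • rot u :=
  ⟨_, by simpa [h] using plane_decomp hu x⟩

end Plane

/-- If `p` lay on no face, compactness of the unit circle would give `m > 0` with `h(u) - ⟨p, u⟩ ≥
m‖u‖`; then `C` would contain a disc about `p`, hence a step along `w`. -/
theorem exists_face_mem_of_forall_add_smul_notMem {C : ConvexBody Plane} {p w : Plane} (hp : p ∈ C)
    (hw : ∀ ε : ℝ, 0 < ε → p + ε • w ∉ C) : ∃ u ≠ 0, p ∈ face C u := by
  by_contra! hno
  have hpos : ∀ u ≠ 0, 0 < supportFun C u - inner ℝ p u := by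
    intro u hu
    rw [sub_pos]
    by_contra! h
    exact hno u hu (mem_face_iff.2 ⟨hp, h⟩)
  obtain ⟨u₀, hu₀, hmin⟩ := (isCompact_sphere (0 : Plane) 1).exists_isMinOn
    (NormedSpace.sphere_nonempty.2 zero_le_one)
    (f := fun u => supportFun C u - inner ℝ p u)
    ((continuous_supportFun_right C).sub (by fun_prop)).continuousOn
  set m := supportFun C u₀ - inner ℝ p u₀ with hm
  have hm0 : 0 < m := hpos u₀ (ne_zero_of_mem_unit_sphere ⟨u₀, hu₀⟩)
  have hsupp : ∀ u, m * ‖u‖ ≤ supportFun C u - inner ℝ p u := by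
    intro u
    rcases eq_or_ne u 0 with rfl | hu
    · simpa using (inner_le_supportFun hp (0 : Plane))
    have hn : 0 < ‖u‖ := norm_pos_iff.2 hu
    have h1 : m ≤ _ := hmin (show ‖u‖⁻¹ • u ∈ sphere (0 : Plane) 1 by
      simp [norm_smul, hn.ne'])
    simp only at h1
    rw [supportFun_smul _ _ (inv_pos.2 hn), inner_smul_right, ← mul_sub, inv_mul_eq_div,
      le_div_iff₀ hn] at h1
    exact h1
  refine hw (m / (‖w‖ + 1)) (by positivity) (mem_of_forall_inner_le fun u => ?_)
  have h2 := hsupp u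
  rw [inner_add_left, inner_smul_left]
  have h3 : inner ℝ w u ≤ ‖w‖ * ‖u‖ := real_inner_le_norm w u
  have h4 : m / (‖w‖ + 1) * inner ℝ w u ≤ m * ‖u‖ := by
    rw [div_mul_eq_mul_div, div_le_iff₀ (by positivity)]
    have := mul_nonneg hm0.le (norm_nonneg u)
    nlinarith [mul_le_mul_of_nonneg_left h3 hm0.le]
  simp only [conj_trivial]
  linarith

theorem exists_max_add_smul_mem {C : ConvexBody Plane} {x w : Plane} (hx : x ∈ C) (hw : w ≠ 0) :
    ∃ l : ℝ, 0 ≤ l ∧ x + l • w ∈ C ∧ ∀ ε : ℝ, 0 < ε → (x + l • w) + ε • w ∉ C := by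
  have hemb : Topology.IsClosedEmbedding fun l : ℝ => x + l • w :=
    (Homeomorph.addLeft x).isClosedEmbedding.comp (isClosedEmbedding_smul_left hw)
  have hcpt : IsCompact ((fun l : ℝ => x + l • w) ⁻¹' (C : Set Plane)) :=
    hemb.isCompact_preimage C.isCompact
  have h0 : (0 : ℝ) ∈ (fun l : ℝ => x + l • w) ⁻¹' (C : Set Plane) := by simpa using hx
  obtain ⟨l, hl, hmax⟩ := hcpt.exists_isGreatest ⟨0, h0⟩
  refine ⟨l, hmax h0, hl, fun ε hε hmem => ?_⟩
  have : l + ε ∈ (fun l : ℝ => x + l • w) ⁻¹' (C : Set Plane) := by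
    rw [mem_preimage, add_smul, ← add_assoc]; exact hmem
  linarith [hmax this]

/-- All the points lie on one line, so `c` is across `p` from `a` or from `b`, and convexity of the
corresponding set captures `p`. -/
theorem mem_union_of_mem_segment_of_smul_rot {A B : Set Plane} (hA : Convex ℝ A)
    (hB : Convex ℝ B) {p u a b c : Plane} (hu : u ≠ 0) (ha : a ∈ A) (hb : b ∈ B) (hcA : c ∈ A)
    (hcB : c ∈ B) (hau : inner ℝ a u = inner ℝ p u) (hcu : inner ℝ c u = inner ℝ p u)
    (hp : p ∈ segment ℝ a b) : p ∈ A ∪ B := by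
  obtain ⟨s, t, hs, ht, hst, rfl⟩ := hp
  obtain rfl : s = 1 - t := by linarith
  set p := (1 - t) • a + t • b with hp
  obtain ⟨α, hα⟩ := exists_eq_smul_rot_of_inner_eq_zero (x := a - p) hu
    (by rw [inner_sub_left, hau, sub_self])
  obtain ⟨γ, hγ⟩ := exists_eq_smul_rot_of_inner_eq_zero (x := c - p) hu
    (by rw [inner_sub_left, hcu, sub_self])
  have key : ∀ (K : Set Plane), Convex ℝ K → ∀ y z : Plane, y ∈ K → z ∈ K → ∀ μ ν : ℝ, 0 ≤ μ →
      ν ≤ 0 → y - p = μ • rot u → z - p = ν • rot u → p ∈ K := by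
    intro K hK y z hy hz μ ν hμ hν h1 h2
    rcases hμ.eq_or_lt with rfl | hμ'
    · rw [zero_smul, sub_eq_zero] at h1; exact h1 ▸ hy
    have hd : 0 < μ - ν := by linarith
    have hpe : p = (-ν / (μ - ν)) • y + (μ / (μ - ν)) • z := by
      rw [sub_eq_iff_eq_add] at h1 h2
      rw [h1, h2]
      match_scalars <;> field_simp <;> ring
    rw [hpe]
    exact hK hy hz (div_nonneg (by linarith) hd.le) (div_nonneg hμ hd.le)
      (by field_simp; ring)
  rcases ht.eq_or_lt with rfl | ht'
  · left; simpa [hp] using ha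
  have hbp : b - p = (-((1 - t) * α) / t) • rot u := by
    have h1 : t • (b - p) = (-(1 - t)) • (a - p) := by
      rw [hp]; match_scalars <;> ring
    rw [hα, smul_smul] at h1
    rw [← inv_smul_smul₀ ht'.ne' (b - p), h1, smul_smul]
    congr 1; field_simp
  rcases le_total 0 α with h0 | h0 <;> rcases le_total 0 γ with g0 | g0
  · exact Or.inr (key B hB c b hcB hb _ _ g0
      (div_nonpos_of_nonpos_of_nonneg (by nlinarith) ht) hγ hbp)
  · exact Or.inl (key A hA a c ha hcA _ _ h0 g0 hα hγ)
  · exact Or.inl (key A hA c a hcA ha _ _ g0 h0 hγ hα)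
  · exact Or.inr (key B hB b c hb hcB _ _ (div_nonneg (by nlinarith) ht) g0 hbp hγ)

/-- The union of two planar convex bodies is convex if their faces meet in every direction in which
their support functions agree. -/
theorem convex_union_of_faces_inter_nonempty {A B : ConvexBody Plane}
    (h : ∀ u ≠ 0, supportFun A u = supportFun B u → (face A u ∩ face B u).Nonempty) :
    Convex ℝ ((A : Set Plane) ∪ B) := by
  set C := hullUnion A B with hC
  have hAC : ∀ x ∈ A, x ∈ C := fun x hx => subset_convexHull ℝ _ (Or.inl hx)
  have hBC : ∀ x ∈ B, x ∈ C := fun x hx => subset_convexHull ℝ _ (Or.inr hx)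
  -- Boundary points of the hull lie in the union: if `p` is strictly between `a` and `b`, both
  -- endpoints lie on the supporting line at `p`, so the support functions agree there and the faces
  -- share a point.
  have hbd : ∀ p w, p ∈ C → (∀ ε : ℝ, 0 < ε → p + ε • w ∉ C) → p ∈ (A : Set Plane) ∪ B := by
    intro p w hp hw
    obtain ⟨u, hu, hpu⟩ := exists_face_mem_of_forall_add_smul_notMem hp hw
    have hp' := hp
    rw [hC, mem_hullUnion, A.convex.convexHull_union B.convex A.nonempty B.nonempty,
      mem_convexJoin] at hp'
    obtain ⟨a, ha, b, hb, hpab⟩ := hp'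
    by_contra hpn
    have hpa : p ≠ a := fun he => hpn (Or.inl (he ▸ ha))
    have hpb : p ≠ b := fun he => hpn (Or.inr (he ▸ hb))
    obtain ⟨s, t, hs, ht, hst, hpe⟩ := id hpab
    have hs0 : 0 < s := hs.lt_of_ne fun he => hpb (by
      rw [← hpe, ← he, show t = 1 by linarith]; simp)
    have ht0 : 0 < t := ht.lt_of_ne fun he => hpa (by
      rw [← hpe, ← he, show s = 1 by linarith]; simp)
    have hau := hpu.2 a (hAC a ha)
    have hbu := hpu.2 b (hBC b hb)
    have hsum : inner ℝ p u = s * inner ℝ a u + t * inner ℝ b u := by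
      rw [← hpe]; simp [inner_add_left, inner_smul_left]
    have hau' : inner ℝ a u = inner ℝ p u := by
      have : inner ℝ p u = s * inner ℝ p u + t * inner ℝ p u := by rw [← add_mul, hst, one_mul]
      nlinarith
    have hbu' : inner ℝ b u = inner ℝ p u := by
      have : inner ℝ p u = s * inner ℝ p u + t * inner ℝ p u := by rw [← add_mul, hst, one_mul]
      nlinarith
    have hfa : a ∈ face A u := ⟨ha, fun y hy => hau' ▸ hpu.2 y (hAC y hy)⟩
    have hfb : b ∈ face B u := ⟨hb, fun y hy => hbu' ▸ hpu.2 y (hBC y hy)⟩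
    obtain ⟨c, hcA, hcB⟩ := h u hu (by
      rw [← inner_eq_supportFun hfa, ← inner_eq_supportFun hfb, hau', hbu'])
    exact hpn (mem_union_of_mem_segment_of_smul_rot A.convex B.convex hu ha hb hcA.1 hcB.1 hau'
      (by rw [inner_eq_supportFun hcA, ← inner_eq_supportFun hfa, hau']) hpab)
  suffices hsub : (A : Set Plane) ∪ B = C by rw [hsub]; exact C.convex
  refine Subset.antisymm (union_subset hAC hBC) fun x hx => ?_
  by_cases hxA : x ∈ A
  · exact Or.inl hxA
  right
  obtain ⟨u, hu⟩ := exists_supportFun_lt hxA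
  have hu0 : u ≠ 0 := by
    rintro rfl
    obtain ⟨y, hy⟩ := A.nonempty
    have := inner_le_supportFun (K := A) hy (0 : Plane)
    simp at this hu
    linarith
  -- The line through `x` orthogonal to the separating `u` misses `A`, so both of its exit points
  -- from `C` are in `B`, and hence so is `x`.
  have hline : ∀ l : ℝ, ∀ w, inner ℝ w u = 0 → x + l • w ∉ A := fun l w hw hmem => by
    have := inner_le_supportFun hmem u
    rw [inner_add_left, inner_smul_left, hw] at this
    simp at this
    linarith
  have hr := inner_rot_self u
  obtain ⟨l, hl, hlC, hlmax⟩ := exists_max_add_smul_mem hx (rot_ne_zero hu0)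
  obtain ⟨l', hl', hlC', hlmax'⟩ := exists_max_add_smul_mem hx (neg_ne_zero.2 (rot_ne_zero hu0))
  have h1 := (hbd _ _ hlC hlmax).resolve_left (hline l _ hr)
  have h2 := (hbd _ _ hlC' hlmax').resolve_left (hline l' _ (by rw [inner_neg_left, hr, neg_zero]))
  rcases hl.eq_or_lt with rfl | hlpos
  · simpa using h1
  have hxe : x = (l' / (l + l')) • (x + l • rot u) + (l / (l + l')) • (x + l' • -rot u) := by
    match_scalars <;> field_simp <;> ring
  rw [hxe]
  exact B.convex h1 h2 (by positivity) (by positivity) (by field_simp; ring)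

theorem isConvexityPoint_of_faces {K : ConvexBody Plane} {z : Plane}
    (h : ∀ u ≠ 0, supportFun K u - supportFun K (-u) = inner ℝ ((2 : ℝ) • z) u →
      ∃ a ∈ face K u, ∃ b ∈ face K (-u), a + b = (2 : ℝ) • z) : IsConvexityPoint K z := by
  let A : ConvexBody Plane := ⟨(K : Set Plane) - {z}, K.convex.sub (convex_singleton z),
    by rw [sub_eq_add_neg]; exact K.isCompact.add isCompact_singleton.neg, K.nonempty.sub (singleton_nonempty z)⟩
  let B : ConvexBody Plane := ⟨{z} - (K : Set Plane), (convex_singleton z).sub K.convex,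
    by rw [sub_eq_add_neg]; exact isCompact_singleton.add K.isCompact.neg, (singleton_nonempty z).sub K.nonempty⟩
  have hA : ∀ u, ∀ a ∈ face K u, a - z ∈ face A u := by
    rintro u a ha
    refine ⟨sub_mem_sub ha.1 rfl, ?_⟩
    rintro _ ⟨y, hy, _, rfl, rfl⟩
    simp only [inner_sub_left]
    linarith [ha.2 y hy]
  have hB : ∀ u, ∀ b ∈ face K (-u), z - b ∈ face B u := by
    rintro u b hb
    refine ⟨sub_mem_sub rfl hb.1, ?_⟩
    rintro _ ⟨_, rfl, y, hy, rfl⟩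
    have := hb.2 y hy
    simp only [inner_neg_right] at this
    simp only [inner_sub_left]
    linarith
  refine convex_union_of_faces_inter_nonempty (A := A) (B := B) fun u hu he => ?_
  obtain ⟨a₀, ha₀⟩ := face_nonempty K u
  obtain ⟨b₀, hb₀⟩ := face_nonempty K (-u)
  obtain ⟨a, ha, b, hb, hab⟩ := h u hu (by
    rw [← inner_eq_supportFun (hA u a₀ ha₀), ← inner_eq_supportFun (hB u b₀ hb₀)] at he
    rw [← inner_eq_supportFun ha₀, ← inner_eq_supportFun hb₀, inner_smul_left, inner_neg_right]
    simp only [inner_sub_left] at he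
    simp only [conj_trivial]
    linarith)
  refine ⟨a - z, hA u a ha, ?_⟩
  have : a - z = z - b := by
    rw [two_smul] at hab
    rw [sub_eq_sub_iff_add_eq_add, hab]
  exact this ▸ hB u b hb

/-! ### Exposed antipodal sums give convexity points. -/

theorem antitone_of_eventually_sub_le {G : ℝ → ℝ} (hG : Continuous G)
    (h : ∀ s, ∀ ε > 0, ∀ᶠ t in 𝓝[>] s, G t - G s ≤ ε * (t - s)) : Antitone G := by
  intro a b hab
  refine le_of_forall_pos_le_add fun η hη => ?_
  have key : ∀ κ > 0, G b ≤ G a + κ * (b - a) := by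
    intro κ hκ
    refine image_le_of_liminf_slope_right_lt_deriv_boundary' (f := G) (f' := fun _ => 0)
      (B := fun x => G a + κ * (x - a)) (B' := fun _ => κ) hG.continuousOn ?_ (by simp)
      (by fun_prop) ?_ (fun _ _ _ => hκ) (right_mem_Icc.2 hab)
    · intro x _ r hr
      refine Eventually.frequently ?_
      filter_upwards [h x (r / 2) (half_pos hr), self_mem_nhdsWithin] with t ht hxt
      have hpos : 0 < t - x := sub_pos.2 hxt
      rw [slope_def_field, div_lt_iff₀ hpos]
      nlinarith
    · intro x _
      have := (((hasDerivAt_id x).sub_const a).const_mul κ).const_add (G a)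
      simpa using this.hasDerivWithinAt
  have h2 := key (η / (b - a + 1)) (div_pos hη (by linarith))
  have h3 : η / (b - a + 1) * (b - a) ≤ η := by
    rw [div_mul_eq_mul_div, div_le_iff₀ (by linarith)]
    nlinarith
  linarith

theorem eventually_face_subset_right (K : ConvexBody Plane) (u : Plane) {O : Set Plane}
    (hO : IsOpen O) (hKO : face K u ⊆ O) : ∀ᶠ w in 𝓝 u, face K w ⊆ O :=
  (Continuous.prodMk_right K).tendsto u |>.eventually (eventually_face_subset K u hO hKO)

/-- A discrete derivative bound: testing `a` at parameter `s` and `b` at parameter `t` bounds the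
two support functions from below. -/
theorem sub_le_inner_mul_of_mem_face {K : ConvexBody Plane} {u v a b y : Plane} {s t : ℝ}
    (ha : a ∈ face K (u + t • v)) (hb : b ∈ face K (-(u + s • v))) :
    (supportFun K (u + t • v) - supportFun K (-(u + t • v)) - inner ℝ y (u + t • v)) -
      (supportFun K (u + s • v) - supportFun K (-(u + s • v)) - inner ℝ y (u + s • v)) ≤
      inner ℝ (a + b - y) v * (t - s) := by
  have h1 := inner_le_supportFun ha.1 (u + s • v)
  have h2 := inner_le_supportFun hb.1 (-(u + t • v))
  rw [← inner_eq_supportFun ha, ← inner_eq_supportFun hb]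
  simp only [inner_add_right, inner_smul_right, inner_neg_right, inner_add_left, inner_sub_left]
    at h1 h2 ⊢
  linarith

/-- The sums of opposite boundary points with outer normals `u` and `-u`. -/
def antipodalSum (K : ConvexBody Plane) (u : Plane) : Set Plane :=
  face K u + face K (-u)

theorem antipodalSum_neg (K : ConvexBody Plane) (u : Plane) :
    antipodalSum K (-u) = antipodalSum K u := by
  rw [antipodalSum, antipodalSum, neg_neg, add_comm]

theorem antipodalSum_smul (K : ConvexBody Plane) (u : Plane) {t : ℝ} (ht : t ≠ 0) :
    antipodalSum K (t • u) = antipodalSum K u := by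
  rcases ht.lt_or_gt with h | h
  · rw [← antipodalSum_neg, ← neg_smul, antipodalSum, antipodalSum, ← smul_neg,
      face_smul _ _ (neg_pos.2 h), face_smul _ _ (neg_pos.2 h)]
  · rw [antipodalSum, antipodalSum, ← smul_neg, face_smul _ _ h, face_smul _ _ h]

theorem antipodalSum_nonempty (K : ConvexBody Plane) (u : Plane) : (antipodalSum K u).Nonempty :=
  (face_nonempty K u).add (face_nonempty K (-u))

theorem inner_eq_of_mem_antipodalSum {K : ConvexBody Plane} {u x : Plane}
    (hx : x ∈ antipodalSum K u) : inner ℝ x u = supportFun K u - supportFun K (-u) := by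
  obtain ⟨a, ha, b, hb, rfl⟩ := hx
  rw [← inner_eq_supportFun ha, ← inner_eq_supportFun hb]
  simp [inner_add_left]

/-- The function `G` below has one-sided slopes controlled by `⟨x - y, v⟩`, with `x` an antipodal
sum. Maximality makes `G` antitone, and strict maximality makes it cross zero strictly wherever `y`
is missing. -/
theorem mem_antipodalSum_of_strictly_maximal {K : ConvexBody Plane} {y v u₀ u : Plane} (hv : v ≠ 0)
    (hy : y ∈ antipodalSum K u₀) (hu₀ : u₀ ≠ 0)
    (hle : ∀ w ≠ 0, ∀ x ∈ antipodalSum K w, inner ℝ x v ≤ inner ℝ y v)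
    (heq : ∀ w ≠ 0, ∀ x ∈ antipodalSum K w, inner ℝ x v = inner ℝ y v → x = y)
    (hu : u ≠ 0) (hyu : supportFun K u - supportFun K (-u) = inner ℝ y u) :
    y ∈ antipodalSum K u := by
  set e := rot v with he
  have hne : ∀ s : ℝ, e + s • v ≠ 0 := by
    intro s h0
    have h1 : inner ℝ (e + s • v) e = 0 := by rw [h0, inner_zero_left]
    rw [inner_add_left, inner_smul_left, ← real_inner_comm, real_inner_comm _ v, inner_rot_self,
      real_inner_self_eq_norm_sq, norm_rot] at h1
    have : ‖v‖ ≠ 0 := norm_ne_zero_iff.2 hv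
    simp [this] at h1
  -- Up to a nonzero factor, every direction is `v` or lies on the line `e + s • v`; antipodal sums
  -- ignore such factors.
  have hred : ∀ w : Plane, w ≠ 0 →
      (∃ c : ℝ, c ≠ 0 ∧ w = c • v) ∨ ∃ c : ℝ, c ≠ 0 ∧ ∃ s : ℝ, w = c • (e + s • v) := by
    intro w hw
    have hd := plane_decomp hv w
    by_cases h0 : inner ℝ w (rot v) / ‖v‖ ^ 2 = 0
    · left
      rw [h0, zero_smul, zero_add] at hd
      exact ⟨_, fun hc => hw (by rw [hd, hc, zero_smul]), hd⟩
    · right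
      refine ⟨_, h0, (inner ℝ w (rot v) / ‖v‖ ^ 2)⁻¹ * (inner ℝ w v / ‖v‖ ^ 2), ?_⟩
      rw [smul_add, smul_smul, mul_inv_cancel_left₀ h0]
      exact hd
  obtain ⟨x₀, hx₀⟩ := antipodalSum_nonempty K u
  have hx₀u : inner ℝ x₀ u = inner ℝ y u := by rw [inner_eq_of_mem_antipodalSum hx₀, hyu]
  rcases hred u hu with ⟨c, hc, rfl⟩ | ⟨c, hc, s, rfl⟩
  · rw [inner_smul_right, inner_smul_right] at hx₀u
    exact heq _ hu x₀ hx₀ (mul_left_cancel₀ hc hx₀u) ▸ hx₀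
  rw [antipodalSum_smul K _ hc] at hx₀ ⊢
  rw [inner_smul_right, inner_smul_right] at hx₀u
  replace hx₀u := mul_left_cancel₀ hc hx₀u
  by_contra hny
  set G : ℝ → ℝ := fun s =>
    supportFun K (e + s • v) - supportFun K (-(e + s • v)) - inner ℝ y (e + s • v) with hGdef
  have hGs : G s = 0 := by
    rw [hGdef]
    simp only
    rw [← inner_eq_of_mem_antipodalSum hx₀, hx₀u, sub_self]
  have hGle : ∀ s t a b, a ∈ face K (e + t • v) → b ∈ face K (-(e + s • v)) →
      G t - G s ≤ inner ℝ (a + b - y) v * (t - s) := fun s t a b ha hb =>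
    sub_le_inner_mul_of_mem_face ha hb
  have hcurve : Continuous fun s : ℝ => e + s • v := by fun_prop
  have hGcont : Continuous G := by
    refine (((continuous_supportFun_right K).comp hcurve).sub
      ((continuous_supportFun_right K).comp hcurve.neg)).sub (by fun_prop)
  have hopen : ∀ b : Plane, ∀ r : ℝ, IsOpen {a : Plane | inner ℝ (a + b - y) v < r} := fun b r =>
    isOpen_lt (by fun_prop) continuous_const
  have hG : Antitone G := by
    refine antitone_of_eventually_sub_le hGcont fun s ε hε => ?_
    obtain ⟨b, hb⟩ := face_nonempty K (-(e + s • v))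
    have hev := hcurve.continuousAt.eventually
      (eventually_face_subset_right K (e + s • v) (hopen b ε) fun a ha => by
        rw [mem_ofPred_eq, inner_sub_left]
        linarith [hle _ (hne s) (a + b) (add_mem_add ha hb)])
    filter_upwards [nhdsWithin_le_nhds hev, self_mem_nhdsWithin] with t ht hst
    obtain ⟨a, ha⟩ := face_nonempty K (e + t • v)
    have h1 := hGle s t a b ha hb
    have h2 : inner ℝ (a + b - y) v < ε := ht ha
    have h3 : 0 < t - s := sub_pos.2 hst
    nlinarith
  have hlt : ∀ x ∈ antipodalSum K (e + s • v), inner ℝ x v < inner ℝ y v := fun x hx =>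
    (hle _ (hne s) x hx).lt_of_ne fun h => hny (heq _ (hne s) x hx h ▸ hx)
  have hright : ∀ t, s < t → G t < 0 := by
    obtain ⟨b, hb⟩ := face_nonempty K (-(e + s • v))
    have hev := hcurve.continuousAt.eventually
      (eventually_face_subset_right K (e + s • v) (hopen b 0) fun a ha => by
        rw [mem_ofPred_eq, inner_sub_left]
        linarith [hlt (a + b) (add_mem_add ha hb)])
    intro t hst
    obtain ⟨t', ⟨h1, hst', ht't⟩⟩ := ((hev.filter_mono nhdsWithin_le_nhds).and (Ioo_mem_nhdsGT hst)).exists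
    obtain ⟨a, ha⟩ := face_nonempty K (e + t' • v)
    have h2 := hGle s t' a b ha hb
    have h3 : inner ℝ (a + b - y) v < 0 := h1 ha
    have h4 : 0 < t' - s := sub_pos.2 hst'
    have := hG ht't.le
    nlinarith
  have hleft : ∀ t, t < s → 0 < G t := by
    obtain ⟨a, ha⟩ := face_nonempty K (e + s • v)
    have hev := hcurve.neg.continuousAt.eventually
      (eventually_face_subset_right K (-(e + s • v)) (hopen a 0) fun b hb => by
        rw [mem_ofPred_eq, inner_sub_left]
        linarith [hlt (b + a) (add_comm a b ▸ add_mem_add ha hb)])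
    intro t hst
    obtain ⟨t', ⟨h1, ht't, hst'⟩⟩ := ((hev.filter_mono nhdsWithin_le_nhds).and (Ioo_mem_nhdsLT hst)).exists
    obtain ⟨b, hb⟩ := face_nonempty K (-(e + t' • v))
    have h2 := hGle t' s a b ha hb
    have h3 : inner ℝ (b + a - y) v < 0 := h1 hb
    have h4 : 0 < s - t' := sub_pos.2 hst'
    have := hG ht't.le
    rw [add_comm] at h3
    nlinarith
  rcases hred u₀ hu₀ with ⟨c', hc', rfl⟩ | ⟨c', hc', s', rfl⟩
  -- The realising direction `v` is the point at infinity of the line. Strict maximality makes the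
  -- face in direction `-v` the single point `b₀`, so nearby faces keep `G` above the negative value
  -- `G (s + 1)` far out, against monotonicity.
  · rw [antipodalSum_smul K _ hc'] at hy
    obtain ⟨a₀, ha₀, b₀, hb₀, hab⟩ := hy
    simp only at hab
    have hmin : ∀ b ∈ K, inner ℝ b₀ v ≤ inner ℝ b v := fun b hb => by
      have := hb₀.2 b hb
      simp only [inner_neg_right] at this
      linarith
    have huniq : ∀ b ∈ face K (-v), b = b₀ := fun b hb => by
      have h1 := heq v hv (a₀ + b) (add_mem_add ha₀ hb) (by
        rw [← hab, inner_add_left, inner_add_left]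
        have := inner_eq_supportFun hb
        rw [← inner_eq_supportFun hb₀, inner_neg_right, inner_neg_right] at this
        linarith)
      rw [← hab] at h1
      exact add_left_cancel h1
    have hη := hright (s + 1) (by linarith)
    have hO : IsOpen {b : Plane | G (s + 1) < inner ℝ (b - b₀) e} :=
      isOpen_lt continuous_const (by fun_prop)
    have hev := eventually_face_subset_right K (-v) hO fun b hb => by
      rw [mem_ofPred_eq, huniq b hb]; simpa using hη
    have htend : Tendsto (fun r : ℝ => -(r⁻¹ • e + v)) atTop (𝓝 (-v)) := by
      have : Tendsto (fun r : ℝ => -(r⁻¹ • e + v)) atTop (𝓝 (-((0 : ℝ) • e + v))) :=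
        ((tendsto_inv_atTop_zero.smul_const e).add_const v).neg
      simpa using this
    obtain ⟨r, hr1, hr2, hr3⟩ := ((htend.eventually hev).and
      ((eventually_ge_atTop (s + 1)).and (eventually_gt_atTop 0))).exists
    obtain ⟨b, hb⟩ := face_nonempty K (-(r⁻¹ • e + v))
    have hb1 : G (s + 1) < inner ℝ (b - b₀) e := hr1 hb
    have hb' : b ∈ face K (-(e + r • v)) := by
      rw [← face_smul K _ hr3, smul_neg, smul_add, smul_smul, mul_inv_cancel₀ hr3.ne', one_smul]
        at hb
      exact hb
    have h1 := hG hr2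
    have h2 : inner ℝ (b - b₀) e ≤ G r := by
      have h3 := inner_le_supportFun ha₀.1 (e + r • v)
      have h4 := mul_le_mul_of_nonneg_left (hmin b hb.1) hr3.le
      simp only [hGdef]
      rw [← inner_eq_supportFun hb', ← hab]
      simp only [inner_add_right, inner_smul_right, inner_neg_right, inner_add_left,
        inner_sub_left] at h3 h4 ⊢
      linarith
    linarith
  · rw [antipodalSum_smul K _ hc'] at hy
    have hGs' : G s' = 0 := by
      simp only [hGdef]
      rw [← inner_eq_of_mem_antipodalSum hy, sub_self]
    rcases lt_trichotomy s s' with hlt' | rfl | hlt'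
    · exact absurd hGs' (hright s' hlt').ne
    · exact hny hy
    · exact absurd hGs' (hleft s' hlt').ne'

/-- A strictly exposed point of the set of midpoints of opposite boundary points is a convexity
point. -/
theorem isConvexityPoint_of_strictly_maximal {K : ConvexBody Plane} {z v u₀ : Plane} (hv : v ≠ 0)
    (hz : (2 : ℝ) • z ∈ antipodalSum K u₀) (hu₀ : u₀ ≠ 0)
    (hle : ∀ w ≠ 0, ∀ x ∈ antipodalSum K w, inner ℝ x v ≤ inner ℝ ((2 : ℝ) • z) v)
    (heq : ∀ w ≠ 0, ∀ x ∈ antipodalSum K w, inner ℝ x v = inner ℝ ((2 : ℝ) • z) v →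
      x = (2 : ℝ) • z) : IsConvexityPoint K z :=
  isConvexityPoint_of_faces fun _ hu hzu => by
    obtain ⟨a, ha, b, hb, hab⟩ := mem_antipodalSum_of_strictly_maximal hv hz hu₀ hle heq hu hzu
    exact ⟨a, ha, b, hb, hab⟩

/-- Semicontinuity uniformly over the compact set `Q`, by the tube lemma on directions and pairs of
face points. -/
theorem isOpen_setOf_antipodalSum_subset {Q : Set Plane} (hQ : IsCompact Q) {O : Set Plane}
    (hO : IsOpen O) :
    IsOpen {K : ConvexBody Plane | ∀ u ∈ Q, antipodalSum K u ⊆ O} := by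
  rw [isOpen_iff_mem_nhds]
  intro K hK
  obtain ⟨M, -, hM⟩ := exists_forall_dist_lt_one_norm_le K
  have hball : IsCompact (closedBall (0 : Plane) M) := isCompact_closedBall _ _
  have hev := (hQ.prod (hball.prod hball)).eventually_forall_of_forall_eventually (x₀ := K)
    (P := fun L q => q.2.1 ∈ face L q.1 → q.2.2 ∈ face L (-q.1) → q.2.1 + q.2.2 ∈ O) (by
      rintro ⟨u, a, b⟩ ⟨hu, -⟩
      have hop : IsOpen {q : ConvexBody Plane × Plane × Plane × Plane |
          q.2.2.1 ∈ face q.1 q.2.1 → q.2.2.2 ∈ face q.1 (-q.2.1) → q.2.2.1 + q.2.2.2 ∈ O} := by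
        simp only [imp_iff_not_or, ofPred_or]
        refine IsOpen.union ?_ (IsOpen.union ?_ (hO.preimage (by fun_prop)))
        · exact (isClosed_setOf_mem_face.preimage
            (f := fun q : ConvexBody Plane × Plane × Plane × Plane => (q.1, q.2.1, q.2.2.1))
            (by fun_prop)).isOpen_compl
        · exact (isClosed_setOf_mem_face.preimage
            (f := fun q : ConvexBody Plane × Plane × Plane × Plane => (q.1, -q.2.1, q.2.2.2))
            (by fun_prop)).isOpen_compl
      exact hop.mem_nhds fun ha hb => hK u hu (add_mem_add ha hb))
  filter_upwards [hev, ball_mem_nhds K one_pos] with L hL hLK u hu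
  rintro _ ⟨a, ha, b, hb, rfl⟩
  exact hL (u, a, b) ⟨hu, by simpa using hM L hLK a ha.1, by simpa using hM L hLK b hb.1⟩ ha hb

theorem antipodalSum_subset_of_sphere {K : ConvexBody Plane} {O : Set Plane}
    (h : ∀ u ∈ sphere (0 : Plane) 1, antipodalSum K u ⊆ O) {u : Plane} (hu : u ≠ 0) :
    antipodalSum K u ⊆ O := by
  have hn : ‖u‖ ≠ 0 := norm_ne_zero_iff.2 hu
  rw [← antipodalSum_smul K u (inv_ne_zero hn)]
  exact h _ (by simp [norm_smul, hn])

/-- The sums of opposite boundary points that are farthest from a given point are strictly exposed,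
and so give convexity points. -/
theorem exists_isConvexityPoint_of_farthest {K : ConvexBody Plane} {c : Plane} {r : ℝ} (hr : 0 ≤ r)
    {W : Set Plane} {u₀ : Plane} (hu₀ : u₀ ∈ sphere (0 : Plane) 1)
    (h₀ : antipodalSum K u₀ ⊆ (closedBall c r)ᶜ)
    (hW : ∀ u ∈ sphere (0 : Plane) 1, antipodalSum K u ⊆ W ∪ ball c r) :
    ∃ y ∈ W, IsConvexityPoint K ((2 : ℝ)⁻¹ • y) := by
  let T : Set (Plane × Plane × Plane) :=
    {q | q.2.1 ∈ face K q.1 ∧ q.2.2 ∈ face K (-q.1)} ∩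
      (sphere (0 : Plane) 1 ×ˢ (K : Set Plane) ×ˢ (K : Set Plane))
  have hTc : IsCompact T := by
    refine ((isCompact_sphere _ _).prod (K.isCompact.prod K.isCompact)).inter_left ?_
    refine IsClosed.inter (s₁ := {q : Plane × Plane × Plane | q.2.1 ∈ face K q.1})
      (s₂ := {q : Plane × Plane × Plane | q.2.2 ∈ face K (-q.1)}) ?_ ?_
    · exact isClosed_setOf_mem_face.preimage
        (f := fun q : Plane × Plane × Plane => (K, q.1, q.2.1)) (by fun_prop)
    · exact isClosed_setOf_mem_face.preimage
        (f := fun q : Plane × Plane × Plane => (K, -q.1, q.2.2)) (by fun_prop)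
  have hmem : ∀ u ∈ sphere (0 : Plane) 1, ∀ a ∈ face K u, ∀ b ∈ face K (-u), (u, a, b) ∈ T :=
    fun u hu a ha b hb => ⟨⟨ha, hb⟩, hu, ha.1, hb.1⟩
  obtain ⟨a₀, ha₀⟩ := face_nonempty K u₀
  obtain ⟨b₀, hb₀⟩ := face_nonempty K (-u₀)
  obtain ⟨⟨u, a, b⟩, ⟨⟨ha, hb⟩, hu, -⟩, hmax⟩ := hTc.exists_isMaxOn ⟨_, hmem u₀ hu₀ a₀ ha₀ b₀ hb₀⟩
    (f := fun q => dist (q.2.1 + q.2.2) c) (by fun_prop)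
  simp only at ha hb hu
  have hfar : ∀ w ∈ sphere (0 : Plane) 1, antipodalSum K w ⊆ {x | ‖x - c‖ ≤ ‖a + b - c‖} := by
    rintro w hw _ ⟨a', ha', b', hb', rfl⟩
    have := hmax (hmem w hw a' ha' b' hb')
    simp only [dist_eq_norm] at this
    exact this
  have hr' : r < ‖a + b - c‖ := by
    have h1 := h₀ (add_mem_add ha₀ hb₀)
    rw [mem_compl_iff, mem_closedBall, not_le, dist_eq_norm] at h1
    exact h1.trans_le (hfar u₀ hu₀ (add_mem_add ha₀ hb₀))
  have hbW : a + b ∈ W := (hW u hu (add_mem_add ha hb)).resolve_right (by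
    rw [mem_ball, not_lt, dist_eq_norm]; exact hr'.le)
  -- A disc is strictly convex: its boundary point `a + b` is strictly exposed by the radial vector
  -- `a + b - c`.
  have hexp : ∀ x, ‖x - c‖ ≤ ‖a + b - c‖ →
      2 * inner ℝ (x - (a + b)) (a + b - c) + ‖x - (a + b)‖ ^ 2 ≤ 0 := by
    intro x hx
    have h1 := norm_add_sq_real (x - (a + b)) (a + b - c)
    rw [sub_add_sub_cancel] at h1
    have h2 := pow_le_pow_left₀ (norm_nonneg _) hx 2
    linarith
  refine ⟨a + b, hbW, isConvexityPoint_of_strictly_maximal (v := a + b - c) (u₀ := u)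
    (norm_pos_iff.1 (hr.trans_lt hr')) ?_ (ne_zero_of_mem_unit_sphere ⟨u, hu⟩) ?_ ?_⟩
  · rw [smul_inv_smul₀ two_ne_zero]; exact add_mem_add ha hb
  · intro w hw x hx
    rw [smul_inv_smul₀ two_ne_zero]
    have := hexp x (antipodalSum_subset_of_sphere hfar hw hx)
    rw [inner_sub_left] at this
    linarith [sq_nonneg ‖x - (a + b)‖]
  · intro w hw x hx he
    rw [smul_inv_smul₀ two_ne_zero] at he ⊢
    have := hexp x (antipodalSum_subset_of_sphere hfar hw hx)
    rw [inner_sub_left, he, sub_self, mul_zero, zero_add] at this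
    have h0 : ‖x - (a + b)‖ = 0 := pow_eq_zero_iff two_ne_zero |>.1
      (le_antisymm this (sq_nonneg _))
    exact sub_eq_zero.1 (norm_eq_zero.1 h0)

/-! ### The open condition and its consequences. -/

/-- The convex bodies with `n` stably separated farthest sums of opposite boundary points. -/
def manyFarthest (n : ℕ) : Set (ConvexBody Plane) :=
  {K | ∃ (W : Fin n → Set Plane) (c u : Fin n → Plane) (r : Fin n → ℝ),
    Pairwise (fun i j => Disjoint (W i) (W j)) ∧ ∀ i, IsOpen (W i) ∧ 0 ≤ r i ∧
      u i ∈ sphere (0 : Plane) 1 ∧ antipodalSum K (u i) ⊆ (closedBall (c i) (r i))ᶜ ∧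
      ∀ w ∈ sphere (0 : Plane) 1, antipodalSum K w ⊆ W i ∪ ball (c i) (r i)}

theorem isOpen_manyFarthest (n : ℕ) : IsOpen (manyFarthest n) := by
  rw [isOpen_iff_mem_nhds]
  rintro K ⟨W, c, u, r, hdisj, h⟩
  have h1 : ∀ᶠ L in 𝓝 K, ∀ i, (∀ w ∈ ({u i} : Set Plane),
      antipodalSum L w ⊆ (closedBall (c i) (r i))ᶜ) ∧
      ∀ w ∈ sphere (0 : Plane) 1, antipodalSum L w ⊆ W i ∪ ball (c i) (r i) := by
    rw [eventually_all]
    intro i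
    obtain ⟨hWo, -, -, h2, h3⟩ := h i
    refine Filter.Eventually.and ?_ ?_
    · exact (isOpen_setOf_antipodalSum_subset isCompact_singleton
        isClosed_closedBall.isOpen_compl).mem_nhds (by simpa using h2)
    · exact (isOpen_setOf_antipodalSum_subset (isCompact_sphere _ _)
        (hWo.union isOpen_ball)).mem_nhds h3
  filter_upwards [h1] with L hL
  exact ⟨W, c, u, r, hdisj, fun i => ⟨(h i).1, (h i).2.1, (h i).2.2.1, (hL i).1 _ rfl, (hL i).2⟩⟩

theorem infinite_of_forall_mem_manyFarthest {K : ConvexBody Plane}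
    (h : ∀ n, K ∈ manyFarthest (n + 1)) : {z | IsConvexityPoint K z}.Infinite := by
  intro hfin
  set S := {z | IsConvexityPoint K z}
  obtain ⟨W, c, u, r, hdisj, hK⟩ := h (Nat.card S)
  have hex : ∀ i, ∃ y ∈ W i, IsConvexityPoint K ((2 : ℝ)⁻¹ • y) := fun i =>
    exists_isConvexityPoint_of_farthest (hK i).2.1 (hK i).2.2.1 (hK i).2.2.2.1 (hK i).2.2.2.2
  choose y hyW hy using hex
  have : Finite S := hfin
  have hinj : Function.Injective fun i => (⟨(2 : ℝ)⁻¹ • y i, hy i⟩ : S) := by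
    intro i j hij
    have h1 : y i = y j :=
      smul_right_injective _ (inv_ne_zero (two_ne_zero (α := ℝ))) (Subtype.ext_iff.1 hij)
    by_contra hne
    exact disjoint_left.1 (hdisj hne) (hyW i) (h1 ▸ hyW j)
  have := Nat.card_le_card_of_injective _ hinj
  simp at this

theorem exists_pos_forall_two_mul_lt_dist {ι X : Type*} [Finite ι] [MetricSpace X] {y : ι → X}
    (hy : Function.Injective y) {R : ℝ} (hR : 0 < R) :
    ∃ ρ > 0, ρ < R ∧ ∀ i j, i ≠ j → 2 * ρ < dist (y i) (y j) := by
  have h1 : ∀ᶠ ρ in 𝓝[>] (0 : ℝ), ∀ i j, i ≠ j → 2 * ρ < dist (y i) (y j) := by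
    simp only [eventually_all]
    intro i j hij
    have : Tendsto (fun ρ : ℝ => 2 * ρ) (𝓝[>] 0) (𝓝 0) := by
      have : Continuous fun ρ : ℝ => 2 * ρ := by fun_prop
      simpa using (this.tendsto 0).mono_left nhdsWithin_le_nhds
    exact this.eventually_lt_const (dist_pos.2 (hy.ne hij))
  obtain ⟨ρ, h2, hρ⟩ := (h1.and (Ioo_mem_nhdsGT hR)).exists
  exact ⟨ρ, hρ.1, hρ.2, h2⟩

/-- Several extreme sums on one circle about `c` are told apart by moving the centre: from the
reflected point `2c - y i`, only points near `y i` can be at distance close to `2R`. -/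
theorem mem_manyFarthest {n : ℕ} {K : ConvexBody Plane} {c : Plane} {R : ℝ} (hR : 0 < R)
    (hK : ∀ u ≠ 0, antipodalSum K u ⊆ closedBall c R) {y : Fin n → Plane}
    (hy : Function.Injective y) (hyR : ∀ i, dist (y i) c = R)
    (hlim : ∀ i, ∀ δ > 0, ∃ u ≠ 0, antipodalSum K u ⊆ ball (y i) δ) : K ∈ manyFarthest n := by
  obtain ⟨ρ, hρ0, hρR, hρ⟩ := exists_pos_forall_two_mul_lt_dist hy hR
  have hpos : 0 ≤ 4 * R ^ 2 - ρ ^ 2 / 2 := by nlinarith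
  have hfar : ∀ i, y i ∈ (closedBall ((2 : ℝ) • c - y i) (√(4 * R ^ 2 - ρ ^ 2 / 2)))ᶜ := by
    intro i
    have h1 : dist (y i) ((2 : ℝ) • c - y i) = 2 * R := by
      rw [dist_eq_norm, show y i - ((2 : ℝ) • c - y i) = (2 : ℝ) • (y i - c) by module, norm_smul,
        ← dist_eq_norm, hyR]
      simp
    rw [mem_compl_iff, mem_closedBall, h1, not_le, Real.sqrt_lt' (by positivity)]
    nlinarith
  have hu : ∀ i, ∃ u ∈ sphere (0 : Plane) 1, antipodalSum K u ⊆
      (closedBall ((2 : ℝ) • c - y i) (√(4 * R ^ 2 - ρ ^ 2 / 2)))ᶜ := by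
    intro i
    obtain ⟨δ, hδ, hsub⟩ := Metric.isOpen_iff.1 isClosed_closedBall.isOpen_compl _ (hfar i)
    obtain ⟨u, hu, hKu⟩ := hlim i δ hδ
    have hn : ‖u‖ ≠ 0 := norm_ne_zero_iff.2 hu
    refine ⟨‖u‖⁻¹ • u, by simp [norm_smul, hn], ?_⟩
    rw [antipodalSum_smul K u (inv_ne_zero hn)]
    exact hKu.trans hsub
  choose u hu hKu using hu
  refine ⟨fun i => ball (y i) ρ, fun i => (2 : ℝ) • c - y i, u,
    fun _ => √(4 * R ^ 2 - ρ ^ 2 / 2), fun i j hij => ball_disjoint_ball (by linarith [hρ i j hij]),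
    fun i => ⟨isOpen_ball, Real.sqrt_nonneg _, hu i, hKu i, fun w hw x hx => ?_⟩⟩
  by_cases hxi : x ∈ ball (y i) ρ
  · exact Or.inl hxi
  right
  rw [mem_ball, not_lt, dist_eq_norm] at hxi
  have hxR : ‖x - c‖ ≤ R := by
    rw [← dist_eq_norm]; exact hK w (ne_zero_of_mem_unit_sphere ⟨w, hw⟩) hx
  have hyi : ‖y i - c‖ = R := by rw [← dist_eq_norm, hyR]
  rw [mem_ball, dist_eq_norm]
  refine Real.lt_sqrt_of_sq_lt ?_
  -- A point at distance at least `ρ` from `y i` has squared distance at most `4R² - ρ²` from the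
  -- reflected centre; the radius uses `ρ²/2` to leave a margin.
  have hpar := parallelogram_law_with_norm ℝ (x - c) (y i - c)
  rw [show x - c + (y i - c) = x - ((2 : ℝ) • c - y i) by module, sub_sub_sub_cancel_right, hyi]
    at hpar
  nlinarith [norm_nonneg (x - c), norm_nonneg (x - y i)]

/-! ### Polygons in general position. -/

/-- The convex hull of a finite family of points. -/
noncomputable def polygon {ι : Type*} [Finite ι] [Nonempty ι] (V : ι → Plane) :
    ConvexBody Plane where
  carrier := convexHull ℝ (range V)
  convex' := convex_convexHull ℝ _
  isCompact' := (finite_range V).isCompact_convexHull (𝕜 := ℝ)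
  nonempty' := (range_nonempty V).convexHull

/-- No two of the lines spanned by two points of the family are parallel. -/
def NoParallel {ι : Type*} (V : ι → Plane) : Prop :=
  ∀ u ≠ 0, ∀ i j k l, i ≠ j → k ≠ l → inner ℝ (V i - V j) u = 0 → inner ℝ (V k - V l) u = 0 →
    (i = k ∧ j = l) ∨ (i = l ∧ j = k)

theorem two_pow_add_two_pow_inj {a b c d : ℕ} (hab : a ≠ b) (hcd : c ≠ d)
    (h : 2 ^ a + 2 ^ b = 2 ^ c + 2 ^ d) : (a = c ∧ b = d) ∨ (a = d ∧ b = c) := by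
  have hs : ({a, b} : Finset ℕ) = {c, d} := by
    apply Finset.geomSum_injective le_rfl
    simpa [Finset.sum_pair hab, Finset.sum_pair hcd] using h
  have h1 : a ∈ ({c, d} : Finset ℕ) := hs ▸ by simp
  have h2 : b ∈ ({c, d} : Finset ℕ) := hs ▸ by simp
  simp only [Finset.mem_insert, Finset.mem_singleton] at h1 h2
  omega

theorem finite_setOf_quadratic_eq_zero {A B C : ℝ} (hC : C ≠ 0) :
    {s : ℝ | C * s ^ 2 + B * s + A = 0}.Finite := by
  have hp : (Polynomial.C C * Polynomial.X ^ 2 + Polynomial.C B * Polynomial.X + Polynomial.C A)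
      ≠ 0 := fun h => by
    have := congrArg (fun p => Polynomial.coeff p 2) h
    simp [hC] at this
  refine (Polynomial.finite_setOfPred_isRoot hp).subset fun s hs => ?_
  simpa [Polynomial.IsRoot] using hs

theorem cross_eq_zero_of_inner_eq_zero {x y u : Plane} (hu : u ≠ 0) (hx : inner ℝ x u = 0)
    (hy : inner ℝ y u = 0) : x 0 * y 1 - x 1 * y 0 = 0 := by
  obtain ⟨s, rfl⟩ := exists_eq_smul_rot_of_inner_eq_zero hu hx
  obtain ⟨t, rfl⟩ := exists_eq_smul_rot_of_inner_eq_zero hu hy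
  simp; ring

/-- Points are moved towards the parabola points `(α, α²)` with `α` distinct powers of two.
Parallelism of two chords is a quadratic equation in the step `s` whose leading coefficient is, up
to sign, `(αᵢ - αⱼ)(αₖ - αₗ)(αᵢ + αⱼ - αₖ - αₗ)`; it is nonzero as sums of two distinct powers of
two determine the pair. So only finitely many `s` are bad. -/
theorem exists_noParallel_near {ι : Type*} [Fintype ι] (V : ι → Plane) {ε : ℝ} (hε : 0 < ε) :
    ∃ V' : ι → Plane, (∀ i, dist (V' i) (V i) < ε) ∧ NoParallel V' := by
  let α : ι → ℝ := fun i => 2 ^ (Fintype.equivFin ι i : ℕ)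
  have hα : ∀ i j k l, i ≠ j → k ≠ l → α i + α j = α k + α l →
      (i = k ∧ j = l) ∨ (i = l ∧ j = k) := by
    intro i j k l hij hkl h
    have hval : ∀ {a b : ι}, (Fintype.equivFin ι a : ℕ) = Fintype.equivFin ι b ↔ a = b := by
      intro a b
      rw [Fin.val_inj, Equiv.apply_eq_iff_eq]
    have := two_pow_add_two_pow_inj (mt hval.1 hij) (mt hval.1 hkl)
      (by simp only [α] at h; exact_mod_cast h)
    simpa only [hval] using this
  have hαinj : ∀ i j, i ≠ j → α i ≠ α j := by
    intro i j hij h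
    refine hij ((Fintype.equivFin ι).injective (Fin.val_injective ?_))
    refine Nat.pow_right_injective le_rfl ?_
    simp only [α] at h ⊢
    exact_mod_cast h
  let w : ι → Plane := fun i => !₂[α i, α i ^ 2]
  let bad : ι × ι × ι × ι → Set ℝ := fun q =>
    {s | (((w q.1 - w q.2.1) 0 * (w q.2.2.1 - w q.2.2.2) 1 -
        (w q.1 - w q.2.1) 1 * (w q.2.2.1 - w q.2.2.2) 0) * s ^ 2 +
      ((V q.1 - V q.2.1) 0 * (w q.2.2.1 - w q.2.2.2) 1 +
        (w q.1 - w q.2.1) 0 * (V q.2.2.1 - V q.2.2.2) 1 -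
        (V q.1 - V q.2.1) 1 * (w q.2.2.1 - w q.2.2.2) 0 -
        (w q.1 - w q.2.1) 1 * (V q.2.2.1 - V q.2.2.2) 0) * s +
      ((V q.1 - V q.2.1) 0 * (V q.2.2.1 - V q.2.2.2) 1 -
        (V q.1 - V q.2.1) 1 * (V q.2.2.1 - V q.2.2.2) 0) = 0) ∧
      q.1 ≠ q.2.1 ∧ q.2.2.1 ≠ q.2.2.2 ∧ ¬ ((q.1 = q.2.2.1 ∧ q.2.1 = q.2.2.2) ∨
        (q.1 = q.2.2.2 ∧ q.2.1 = q.2.2.1))}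
  have hbad : ∀ q, (bad q).Finite := by
    rintro ⟨i, j, k, l⟩
    by_cases hq : i ≠ j ∧ k ≠ l ∧ ¬ ((i = k ∧ j = l) ∨ (i = l ∧ j = k))
    · refine (finite_setOf_quadratic_eq_zero ?_).subset fun s hs => hs.1
      have h1 := sub_ne_zero.2 (hαinj i j hq.1)
      have h2 := sub_ne_zero.2 (hαinj k l hq.2.1)
      have h3 := sub_ne_zero.2 (mt (hα i j k l hq.1 hq.2.1) hq.2.2)
      have h4 := mul_ne_zero (mul_ne_zero h1 h2) h3
      simp only [w, PiLp.sub_apply, Matrix.cons_val_zero, Matrix.cons_val_one]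
      intro h5
      apply h4
      linear_combination -h5
    · exact finite_empty.subset fun s hs => hq hs.2
  have hsmall : ∀ᶠ s in 𝓝[>] (0 : ℝ), ∀ i, dist (V i + s • w i) (V i) < ε := by
    rw [eventually_all]
    intro i
    have hc : Continuous fun s : ℝ => dist (V i + s • w i) (V i) := by fun_prop
    exact ((hc.tendsto 0).mono_left nhdsWithin_le_nhds).eventually_lt_const (by simpa using hε)
  have hgood : ∀ᶠ s in 𝓝[>] (0 : ℝ), s ∉ ⋃ q, bad q := by
    have hfin : (⋃ q, bad q).Finite := finite_iUnion hbad
    have h3 : ((⋃ q, bad q) \ {0})ᶜ ∈ 𝓝 (0 : ℝ) :=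
      (hfin.subset sdiff_subset).isClosed.isOpen_compl.mem_nhds (by simp)
    filter_upwards [nhdsWithin_le_nhds h3, self_mem_nhdsWithin] with s hs hs0 hmem
    exact hs ⟨hmem, ne_of_gt hs0⟩
  obtain ⟨s, hs1, hs2⟩ := (hsmall.and hgood).exists
  refine ⟨fun i => V i + s • w i, hs1, fun u hu i j k l hij hkl h1 h2 => ?_⟩
  by_contra hne
  refine hs2 (mem_iUnion.2 ⟨(i, j, k, l), ?_, hij, hkl, hne⟩)
  have := cross_eq_zero_of_inner_eq_zero hu h1 h2
  simp only [PiLp.sub_apply, PiLp.add_apply, PiLp.smul_apply, smul_eq_mul] at this ⊢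
  linear_combination this

theorem vertex_mem_polygon {ι : Type*} [Finite ι] [Nonempty ι] (V : ι → Plane) (i : ι) : V i ∈ polygon V :=
  subset_convexHull ℝ _ (mem_range_self i)

theorem face_polygon_subset {ι : Type*} [Finite ι] [Nonempty ι] {V : ι → Plane} {u : Plane} :
    face (polygon V) u ⊆ convexHull ℝ (V '' {i | ∀ k, inner ℝ (V k) u ≤ inner ℝ (V i) u}) := by
  intro x hx
  refine convexHull_mono ?_ (mem_convexHull_inter_of_inner_eq (S := range V) (u := u)
    (M := inner ℝ x u) ?_ hx.1 le_rfl)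
  · rintro _ ⟨⟨i, rfl⟩, hi⟩
    refine ⟨i, fun k => ?_, rfl⟩
    rw [show inner ℝ (V i) u = inner ℝ x u from hi]
    exact hx.2 _ (vertex_mem_polygon V k)
  · rintro _ ⟨i, rfl⟩
    exact hx.2 _ (vertex_mem_polygon V i)

theorem face_polygon_subset_singleton {ι : Type*} [Finite ι] [Nonempty ι] 
    {V : ι → Plane} {u : Plane} {i : ι}
    (h : ∀ k ≠ i, inner ℝ (V k) u < inner ℝ (V i) u) : face (polygon V) u ⊆ {V i} := by
  refine face_polygon_subset.trans (convexHull_min ?_ (convex_singleton _))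
  rintro _ ⟨j, hj, rfl⟩
  by_contra hne
  have hji : j ≠ i := fun he => hne (by rw [he]; rfl)
  exact absurd (hj i) (not_le.2 (h j hji))

/-- The points `V i` and `V j` are the unique points of the family farthest in the directions `u`
and `-u`. -/
def IsAntipodalPair {ι : Type*} (V : ι → Plane) (u : Plane) (i j : ι) : Prop :=
  (∀ k ≠ i, inner ℝ (V k) u < inner ℝ (V i) u) ∧ ∀ k ≠ j, inner ℝ (V j) u < inner ℝ (V k) u

theorem IsAntipodalPair.eventually {ι : Type*} [Finite ι] {V : ι → Plane} {u : Plane} {i j : ι}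
    (h : IsAntipodalPair V u i j) :
    ∀ᶠ w in 𝓝 u, IsAntipodalPair V w i j := by
  refine Eventually.and ?_ ?_ <;> rw [eventually_all] <;> intro k <;> rw [eventually_imp_distrib_left]
  · intro hk
    exact ContinuousAt.eventually_lt (by fun_prop) (by fun_prop) (h.1 k hk)
  · intro hk
    exact ContinuousAt.eventually_lt (by fun_prop) (by fun_prop) (h.2 k hk)

theorem IsAntipodalPair.antipodalSum_subset {ι : Type*} [Finite ι] [Nonempty ι] 
    {V : ι → Plane} {u : Plane} {i j : ι} (h : IsAntipodalPair V u i j) :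
    antipodalSum (polygon V) u ⊆ {V i + V j} := by
  rw [← singleton_add_singleton]
  refine add_subset_add (face_polygon_subset_singleton h.1) (face_polygon_subset_singleton ?_)
  intro k hk
  simpa only [inner_neg_right, neg_lt_neg_iff] using h.2 k hk

/-- A coincident pair has zero difference, which is orthogonal to the normal of any line through a
third point. -/
theorem NoParallel.injective {ι : Type*} {V : ι → Plane} (hV : NoParallel V)
    (hcard : 3 ≤ Nat.card ι) : Function.Injective V := by
  intro i j hij
  by_contra hne
  have : Finite ι := Nat.finite_of_card_ne_zero (by omega)
  obtain ⟨k, hki, hkj⟩ : ∃ k, k ≠ i ∧ k ≠ j := by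
    by_contra! h
    have huniv : (univ : Set ι) ⊆ {i, j} := fun k _ => by
      by_cases hk : k = i
      · exact Or.inl hk
      · exact Or.inr (h k hk)
    have h1 := ncard_le_ncard huniv (toFinite _)
    rw [ncard_univ, ncard_pair hne] at h1
    omega
  obtain ⟨u, hu, hku⟩ : ∃ u : Plane, u ≠ 0 ∧ inner ℝ (V k - V i) u = 0 := by
    by_cases h0 : V k - V i = 0
    · obtain ⟨u, hu⟩ := exists_ne (0 : Plane)
      exact ⟨u, hu, by rw [h0, inner_zero_left]⟩
    · exact ⟨rot (V k - V i), rot_ne_zero h0, by rw [real_inner_comm, inner_rot_self]⟩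
  rcases hV u hu k i i j hki hne hku (by rw [hij, sub_self, inner_zero_left]) with h | h
  · exact hki h.1
  · exact hkj h.1

/-- General position allows only one tied pair per direction, so a tie on one side rules out a tie
on the other and can be broken along its own edge. -/
theorem NoParallel.inner_lt_of_tie {ι : Type*} {V : ι → Plane} (hV : NoParallel V)
    (hinj : Function.Injective V) {u : Plane} (hu : u ≠ 0) {i i' j : ι} (hi' : i' ≠ i)
    (htie : inner ℝ (V i') u = inner ℝ (V i) u) (hij : inner ℝ (V j) u ≠ inner ℝ (V i) u) :
    (∀ k ≠ i, inner ℝ (V k) u = inner ℝ (V i) u →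
      inner ℝ (V k) (V i - V i') < inner ℝ (V i) (V i - V i')) ∧
      ∀ k ≠ j, inner ℝ (V k) u ≠ inner ℝ (V j) u := by
  have hsub : ∀ k l, inner ℝ (V k) u = inner ℝ (V l) u → inner ℝ (V k - V l) u = 0 :=
    fun k l h => by rw [inner_sub_left, h, sub_self]
  constructor
  · intro k hk hke
    rcases hV u hu k i i' i hk hi' (hsub _ _ hke) (hsub _ _ htie) with h | h
    · rw [h.1, ← sub_pos, ← inner_sub_left, real_inner_self_eq_norm_sq]
      have := norm_pos_iff.2 (sub_ne_zero.2 (hinj.ne hi'.symm))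
      positivity
    · exact absurd h.1 hk
  · intro k hk hke
    rcases hV u hu k j i' i hk hi' (hsub _ _ hke) (hsub _ _ htie) with h | h
    · exact hij (by rw [h.2])
    · exact hij (by rw [h.2, htie])

/-- Tilting `u` slightly by a tie-breaking vector `d` makes any chosen pair of extreme vertices the
unique one. -/
theorem NoParallel.exists_isAntipodalPair {ι : Type*} [Finite ι] {V : ι → Plane}
    (hV : NoParallel V) (hcard : 3 ≤ Nat.card ι) {u : Plane}
    (hu : u ≠ 0) {i j : ι} (hi : ∀ k, inner ℝ (V k) u ≤ inner ℝ (V i) u)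
    (hj : ∀ k, inner ℝ (V j) u ≤ inner ℝ (V k) u) : ∃ w, IsAntipodalPair V w i j := by
  have hinj := hV.injective hcard
  have hij : inner ℝ (V j) u ≠ inner ℝ (V i) u := by
    intro h
    have heq : ∀ k l, inner ℝ (V k - V l) u = 0 := fun k l => by
      rw [inner_sub_left, sub_eq_zero]
      linarith [hi k, hi l, hj k, hj l]
    have : Fintype ι := Fintype.ofFinite ι
    rw [Nat.card_eq_fintype_card] at hcard
    obtain ⟨a, b, c, hab, hac, hbc⟩ := Fintype.two_lt_card_iff.1 hcard
    rcases hV u hu a b a c hab hac (heq _ _) (heq _ _) with h | h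
    · exact hbc h.2
    · exact hac h.1
  obtain ⟨d, hd1, hd2⟩ : ∃ d : Plane, (∀ k ≠ i, inner ℝ (V k) u = inner ℝ (V i) u →
      inner ℝ (V k) d < inner ℝ (V i) d) ∧ ∀ k ≠ j, inner ℝ (V k) u = inner ℝ (V j) u →
      inner ℝ (V j) d < inner ℝ (V k) d := by
    by_cases h1 : ∃ i' ≠ i, inner ℝ (V i') u = inner ℝ (V i) u
    · obtain ⟨i', hi', he⟩ := h1
      obtain ⟨h2, h3⟩ := hV.inner_lt_of_tie hinj hu hi' he hij
      exact ⟨_, h2, fun k hk hke => absurd hke (h3 k hk)⟩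
    by_cases h2 : ∃ j' ≠ j, inner ℝ (V j') u = inner ℝ (V j) u
    · obtain ⟨j', hj', he⟩ := h2
      obtain ⟨h2, h3⟩ := hV.inner_lt_of_tie hinj hu hj' he hij.symm
      refine ⟨-(V j - V j'), fun k hk hke => absurd hke (h3 k hk), fun k hk hke => ?_⟩
      simpa only [inner_neg_right, neg_lt_neg_iff] using h2 k hk hke
    · push Not at h1 h2
      exact ⟨0, fun k hk hke => absurd hke (h1 k hk), fun k hk hke => absurd hke (h2 k hk)⟩
  have key : ∀ p q : ι, inner ℝ (V p) u ≤ inner ℝ (V q) u →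
      (inner ℝ (V p) u = inner ℝ (V q) u → inner ℝ (V p) d < inner ℝ (V q) d) →
      ∀ᶠ s in 𝓝[>] (0 : ℝ), inner ℝ (V p) (u + s • d) < inner ℝ (V q) (u + s • d) := by
    intro p q hle hlt
    rcases hle.eq_or_lt with h | h
    · filter_upwards [self_mem_nhdsWithin] with s hs
      rw [inner_add_right, inner_add_right, inner_smul_right, inner_smul_right, h]
      exact add_lt_add_right (mul_lt_mul_of_pos_left (hlt h) hs) _
    · refine nhdsWithin_le_nhds (ContinuousAt.eventually_lt (by fun_prop) (by fun_prop) ?_)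
      simpa using h
  have hev : ∀ᶠ s in 𝓝[>] (0 : ℝ), IsAntipodalPair V (u + s • d) i j := by
    refine Eventually.and ?_ ?_ <;> rw [eventually_all] <;> intro k <;>
      rw [eventually_imp_distrib_left] <;> intro hk
    · exact key k i (hi k) (hd1 k hk)
    · exact key j k (hj k) fun h => hd2 k hk h.symm
  exact hev.exists.imp' (fun s => u + s • d) fun _ h => h

theorem antipodalSum_polygon_subset {ι : Type*} [Finite ι] [Nonempty ι] {V : ι → Plane}
    {u : Plane} {S : Set Plane} (hS : Convex ℝ S)
    (h : ∀ i j, (∀ k, inner ℝ (V k) u ≤ inner ℝ (V i) u) →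
      (∀ k, inner ℝ (V j) u ≤ inner ℝ (V k) u) → V i + V j ∈ S) :
    antipodalSum (polygon V) u ⊆ S := by
  refine (add_subset_add face_polygon_subset face_polygon_subset).trans ?_
  rw [← convexHull_add]
  refine convexHull_min ?_ hS
  rintro _ ⟨_, ⟨i, hi, rfl⟩, _, ⟨j, hj, rfl⟩, rfl⟩
  exact h i j hi fun k => by simpa only [inner_neg_right, neg_le_neg_iff] using hj k

/-- Every sum of opposite extreme vertices is already realised by a strict pair, so maximise over
these finitely many pairs; strictness persists for nearby directions. -/
theorem NoParallel.exists_farthest {ι : Type*} [Finite ι] [Nonempty ι] {V : ι → Plane}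
    (hV : NoParallel V) (hcard : 3 ≤ Nat.card ι) (c : Plane) :
    ∃ y u : Plane, (∀ w ≠ 0, antipodalSum (polygon V) w ⊆ closedBall c (dist y c)) ∧
      ∀ᶠ w in 𝓝 u, antipodalSum (polygon V) w ⊆ {y} := by
  have hex : ∀ u : Plane, ∃ i j, (∀ k, inner ℝ (V k) u ≤ inner ℝ (V i) u) ∧
      ∀ k, inner ℝ (V j) u ≤ inner ℝ (V k) u := fun u => by
    obtain ⟨i, hi⟩ := Finite.exists_max fun k => inner ℝ (V k) u
    obtain ⟨j, hj⟩ := Finite.exists_min fun k => inner ℝ (V k) u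
    exact ⟨i, j, hi, hj⟩
  let N : Set (ι × ι) := {p | ∃ w, IsAntipodalPair V w p.1 p.2}
  have hN : N.Nonempty := by
    obtain ⟨u, hu⟩ := exists_ne (0 : Plane)
    obtain ⟨i, j, hi, hj⟩ := hex u
    exact ⟨(i, j), hV.exists_isAntipodalPair hcard hu hi hj⟩
  obtain ⟨⟨i, j⟩, ⟨u, hu⟩, hmax⟩ := exists_max_image N (fun p => dist (V p.1 + V p.2) c)
    (toFinite N) hN
  refine ⟨V i + V j, u, fun w hw => ?_, hu.eventually.mono fun w hw => hw.antipodalSum_subset⟩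
  refine antipodalSum_polygon_subset (convex_closedBall _ _) fun k l hk hl => ?_
  exact hmax (k, l) (hV.exists_isAntipodalPair hcard hw hk hl)

theorem exists_polygon_near (K : ConvexBody Plane) {ε : ℝ} (hε : 0 < ε) :
    ∃ P : ConvexBody Plane, dist P K < ε ∧ ∀ c : Plane, ∃ y u : Plane,
      (∀ w ≠ 0, antipodalSum P w ⊆ closedBall c (dist y c)) ∧
      ∀ᶠ w in 𝓝 u, antipodalSum P w ⊆ {y} := by
  obtain ⟨t, htK, htfin, hcov⟩ := finite_cover_balls_of_compact K.isCompact
    (show 0 < ε / 3 by positivity)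
  have ht0 : t.Nonempty := by
    obtain ⟨x, hx⟩ := K.nonempty
    obtain ⟨y, hy, -⟩ := mem_iUnion₂.1 (hcov hx)
    exact ⟨y, hy⟩
  have : Nonempty t := ht0.to_subtype
  have : Fintype t := htfin.fintype
  -- The factor `Fin 3` triples each net point, ensuring the three indices needed for general
  -- position.
  obtain ⟨V, hVt, hV⟩ := exists_noParallel_near (fun p : t × Fin 3 => (p.1 : Plane))
    (show 0 < ε / 3 by positivity)
  have hcard : 3 ≤ Nat.card (t × Fin 3) := by
    rw [Nat.card_prod, Nat.card_fin]
    have : 0 < Nat.card t := Nat.card_pos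
    omega
  refine ⟨polygon V, ?_, hV.exists_farthest hcard⟩
  refine lt_of_le_of_lt (hausdorffDist_le_of_mem_dist (r := 2 * (ε / 3)) (by positivity) ?_ ?_)
    (by linarith)
  · have hsub : (polygon V : Set Plane) ⊆ cthickening (2 * (ε / 3)) (K : Set Plane) := by
      refine convexHull_min ?_ (K.convex.cthickening _)
      rintro _ ⟨p, rfl⟩
      exact mem_cthickening_of_dist_le _ _ _ _ (htK p.1.2) (by linarith [hVt p])
    intro x hx
    have := hsub hx
    rw [K.isCompact.cthickening_eq_biUnion_closedBall (by positivity)] at this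
    obtain ⟨y, hy, hxy⟩ := mem_iUnion₂.1 this
    exact ⟨y, hy, hxy⟩
  · intro x hx
    obtain ⟨y, hy, hxy⟩ := mem_iUnion₂.1 (hcov hx)
    refine ⟨V (⟨y, hy⟩, 0), vertex_mem_polygon V _, ?_⟩
    have h1 := dist_triangle_right x (V (⟨y, hy⟩, 0)) y
    have h2 := hVt (⟨y, hy⟩, 0)
    rw [mem_ball] at hxy
    simp only at h2
    linarith

/-! ### Minkowski perturbation by a disc with spikes. -/

theorem face_add_subset {V : Type*} [NormedAddCommGroup V] [InnerProductSpace ℝ V]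
    (K L : ConvexBody V) (u : V) : face (K + L) u ⊆ face K u + face L u := by
  rintro _ ⟨⟨a, ha, b, hb, rfl⟩, h⟩
  refine add_mem_add ⟨ha, fun x hx => ?_⟩ ⟨hb, fun x hx => ?_⟩
  · have := h (x + b) (add_mem_add hx hb)
    simp only [inner_add_left] at this
    linarith
  · have := h (a + x) (add_mem_add ha hx)
    simp only [inner_add_left] at this
    linarith

theorem face_smul_body_subset {V : Type*} [NormedAddCommGroup V] [InnerProductSpace ℝ V]
    (K : ConvexBody V) (u : V) {t : ℝ} (ht : 0 < t) : face (t • K) u ⊆ t • face K u := by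
  rintro _ ⟨⟨a, ha, rfl⟩, h⟩
  refine smul_mem_smul_set ⟨ha, fun x hx => ?_⟩
  have := h (t • x) (smul_mem_smul_set hx)
  simp only [inner_smul_left, conj_trivial] at this
  exact le_of_mul_le_mul_left this ht

theorem antipodalSum_add_smul_subset (K L : ConvexBody Plane) (u : Plane) {t : ℝ} (ht : 0 < t) :
    antipodalSum (K + t • L) u ⊆ antipodalSum K u + t • antipodalSum L u := by
  have h : ∀ w, face (K + t • L) w ⊆ face K w + t • face L w := fun w =>
    (face_add_subset _ _ _).trans (add_subset_add_left (face_smul_body_subset L w ht))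
  refine (add_subset_add (h u) (h (-u))).trans ?_
  rw [antipodalSum, antipodalSum, smul_add, add_add_add_comm]

theorem dist_add_smul_le (K L : ConvexBody Plane) {t M : ℝ} (ht : 0 ≤ t) (hL0 : 0 ∈ L)
    (hM0 : 0 ≤ M) (hM : ∀ x ∈ L, ‖x‖ ≤ M) : dist (K + t • L) K ≤ t * M := by
  refine hausdorffDist_le_of_mem_dist (by positivity) ?_ ?_
  · rintro _ ⟨a, ha, _, ⟨b, hb, rfl⟩, rfl⟩
    refine ⟨a, ha, ?_⟩
    simp only [dist_eq_norm, add_sub_cancel_left, norm_smul, Real.norm_of_nonneg ht]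
    exact mul_le_mul_of_nonneg_left (hM b hb) ht
  · intro a ha
    exact ⟨a, ⟨a, ha, _, smul_mem_smul_set hL0, by simp⟩, by simpa using by positivity⟩

/-- The closed unit disc. -/
noncomputable def unitDisc : ConvexBody Plane where
  carrier := closedBall 0 1
  convex' := convex_closedBall _ _
  isCompact' := isCompact_closedBall _ _
  nonempty' := ⟨0, by simp⟩

/-- The convex hull of the unit disc and a finite family of points. -/
noncomputable def capBody {ι : Type*} [Finite ι] [Nonempty ι] (a : ι → Plane) : ConvexBody Plane :=
  hullUnion unitDisc (polygon a)

theorem mem_capBody {ι : Type*} [Finite ι] [Nonempty ι] {a : ι → Plane} {x : Plane} :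
    x ∈ capBody a ↔ x ∈ convexHull ℝ (closedBall (0 : Plane) 1 ∪ range a) := by
  rw [← convexHull_convexHull_union_right]
  rfl

theorem zero_mem_capBody {ι : Type*} [Finite ι] [Nonempty ι] (a : ι → Plane) :
    0 ∈ capBody a :=
  mem_capBody.2 (subset_convexHull ℝ _ (Or.inl (by simp)))

theorem norm_le_of_mem_capBody {ι : Type*} [Finite ι] [Nonempty ι] {a : ι → Plane} {M : ℝ}
    (hM : 1 ≤ M) (ha : ∀ i, ‖a i‖ ≤ M) {x : Plane} (hx : x ∈ capBody a) : ‖x‖ ≤ M := by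
  have h : convexHull ℝ (closedBall (0 : Plane) 1 ∪ range a) ⊆ closedBall 0 M := by
    refine convexHull_min (union_subset (closedBall_subset_closedBall hM) ?_)
      (convex_closedBall _ _)
    rintro _ ⟨i, rfl⟩
    simpa using ha i
  simpa using h (mem_capBody.1 hx)

/-- The disc meets its supporting line only at `u`, so a face is spanned by `u` and the spike tips
that reach at least as far. -/
theorem face_capBody_subset {ι : Type*} [Finite ι] [Nonempty ι] {a : ι → Plane} {u : Plane}
    (hu : ‖u‖ = 1) {T : Set Plane} (hT : Convex ℝ T) (hTu : (∀ i, inner ℝ (a i) u ≤ 1) → u ∈ T)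
    (hTa : ∀ i, 1 ≤ inner ℝ (a i) u → a i ∈ T) : face (capBody a) u ⊆ T := by
  intro x hx
  have hmem : ∀ s ∈ closedBall (0 : Plane) 1 ∪ range a, s ∈ capBody a := fun s hs =>
    mem_capBody.2 (subset_convexHull ℝ _ hs)
  have huu : inner ℝ u u = 1 := by rw [real_inner_self_eq_norm_sq, hu, one_pow]
  have h1 : 1 ≤ inner ℝ x u := by
    rw [← huu]
    exact hx.2 u (hmem u (Or.inl (by simp [hu])))
  refine convexHull_min ?_ hT (mem_convexHull_inter_of_inner_eq
    (S := closedBall (0 : Plane) 1 ∪ range a) (u := u) (M := inner ℝ x u)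
    (fun s hs => hx.2 s (hmem s hs)) (mem_capBody.1 hx.1) le_rfl)
  rintro s ⟨hs | ⟨i, rfl⟩, hsx⟩
  · rw [mem_closedBall_zero_iff] at hs
    rw [mem_ofPred_eq] at hsx
    have h2 : inner ℝ s u ≤ ‖s‖ * ‖u‖ := real_inner_le_norm s u
    rw [hu, mul_one] at h2
    have h3 : s = u := by
      have h4 := norm_sub_sq_real s u
      rw [hu] at h4
      have h5 : ‖s - u‖ ^ 2 ≤ 0 := by nlinarith [norm_nonneg s]
      have h6 : ‖s - u‖ = 0 := pow_eq_zero_iff two_ne_zero |>.1 (le_antisymm h5 (sq_nonneg _))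
      exact sub_eq_zero.1 (norm_eq_zero.1 h6)
    rw [h3]
    refine hTu fun i => ?_
    have := hx.2 (a i) (hmem _ (Or.inr ⟨i, rfl⟩))
    linarith
  · rw [mem_ofPred_eq] at hsx
    exact hTa i (hsx ▸ h1)

theorem face_capBody_subset_singleton {ι : Type*} [Finite ι] [Nonempty ι] {a : ι → Plane}
    {u : Plane} (hu : ‖u‖ = 1) (h : ∀ i, inner ℝ (a i) u < 1) : face (capBody a) u ⊆ {u} :=
  face_capBody_subset hu (convex_singleton u) (fun _ => rfl) fun i hi => absurd hi (not_le.2 (h i))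

theorem antipodalSum_capBody_subset {ι : Type*} [Finite ι] [Nonempty ι] {a : ι → Plane}
    {u : Plane} (hu : ‖u‖ = 1) (h : ∀ i, inner ℝ (a i) u < 1) (h' : ∀ i, inner ℝ (a i) (-u) < 1) :
    antipodalSum (capBody a) u ⊆ {0} := by
  refine (add_subset_add (face_capBody_subset_singleton hu h)
    (face_capBody_subset_singleton (by rwa [norm_neg]) h')).trans ?_
  simp

theorem antipodalSum_capBody_subset_segment {ι : Type*} [Finite ι] [Nonempty ι] {a : ι → Plane}
    {u : Plane} (hu : ‖u‖ = 1) {i : ι} (h : ∀ j ≠ i, inner ℝ (a j) u < 1)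
    (h' : ∀ i, inner ℝ (a i) (-u) < 1) :
    antipodalSum (capBody a) u ⊆ segment ℝ 0 (a i - u) := by
  have h1 : face (capBody a) u ⊆ segment ℝ u (a i) := by
    refine face_capBody_subset hu (convex_segment _ _) (fun _ => left_mem_segment ℝ _ _)
      fun j hj => ?_
    by_cases hji : j = i
    · exact hji ▸ right_mem_segment ℝ _ _
    · exact absurd hj (not_le.2 (h j hji))
  rintro _ ⟨x, hx, y, hy, rfl⟩
  obtain rfl : y = -u := face_capBody_subset_singleton (by rwa [norm_neg]) h' hy
  obtain ⟨p, q, hp, hq, hpq, rfl⟩ := h1 hx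
  refine ⟨p, q, hp, hq, hpq, ?_⟩
  obtain rfl : p = 1 - q := by linarith
  module

theorem antipodalSum_capBody_subset_singleton {ι : Type*} [Finite ι] [Nonempty ι] {a : ι → Plane}
    {u : Plane} (hu : ‖u‖ = 1) {i : ι} (hi : 1 < inner ℝ (a i) u) (h : ∀ j ≠ i, inner ℝ (a j) u < 1)
    (h' : ∀ i, inner ℝ (a i) (-u) < 1) :
    antipodalSum (capBody a) u ⊆ {a i - u} := by
  have h1 : face (capBody a) u ⊆ {a i} := by
    refine face_capBody_subset hu (convex_singleton _) (fun h => absurd (h i) (not_le.2 hi))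
      fun j hj => ?_
    by_cases hji : j = i
    · exact hji ▸ rfl
    · exact absurd hj (not_le.2 (h j hji))
  refine (add_subset_add h1
    (face_capBody_subset_singleton (by rwa [norm_neg]) h')).trans ?_
  simp [sub_eq_add_neg]

theorem inner_sq_add_inner_rot_sq {e : Plane} (he : ‖e‖ = 1) (x : Plane) :
    inner ℝ e x ^ 2 + inner ℝ (rot e) x ^ 2 = ‖x‖ ^ 2 := by
  have h := norm_sq_plane e
  rw [he] at h
  rw [norm_sq_plane, inner_plane, inner_plane]
  simp only [rot_apply_zero, rot_apply_one]
  linear_combination (-(x 0 ^ 2 + x 1 ^ 2)) * h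

/-- The cap of the spike `e + τ • rot e` is the arc starting at `e` and turning towards `rot e`; on
it `1 - ⟨e, u⟩` is at most `τ` times the sideways component. -/
theorem inner_cap_bounds {e u : Plane} (he : ‖e‖ = 1) (hu : ‖u‖ = 1) {τ : ℝ} (hτ : 0 < τ)
    (h : 1 ≤ inner ℝ (e + τ • rot e) u) :
    0 ≤ inner ℝ (rot e) u ∧ inner ℝ (rot e) u ≤ 1 ∧
      1 - inner ℝ e u ≤ τ * inner ℝ (rot e) u ∧ 0 ≤ 1 - inner ℝ e u := by
  have h1 := real_inner_le_norm e u
  have h2 := real_inner_le_norm (rot e) u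
  rw [norm_rot] at h2
  rw [he, hu, one_mul] at h1 h2
  rw [inner_add_left, inner_smul_left, conj_trivial] at h
  refine ⟨?_, h2, by linarith, by linarith⟩
  by_contra! hneg
  nlinarith

theorem norm_sub_sq_le_of_cap {e u : Plane} (he : ‖e‖ = 1) (hu : ‖u‖ = 1) {τ : ℝ} (hτ : 0 < τ)
    (h : 1 ≤ inner ℝ (e + τ • rot e) u) : ‖u - e‖ ^ 2 ≤ 2 * τ := by
  obtain ⟨-, h2, h3, -⟩ := inner_cap_bounds he hu hτ h
  rw [norm_sub_sq_real, he, hu, real_inner_comm]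
  nlinarith

/-- Moving from `e` into the cap costs a first-order amount `κ` along `rot e`, which outweighs the
gains of order `τ`. This makes the cap's endpoint `e` the farthest one. -/
theorem norm_add_smul_sub_le_of_cap {e u : Plane} (he : ‖e‖ = 1) (hu : ‖u‖ = 1) {τ : ℝ}
    (hτ : 0 < τ) (h : 1 ≤ inner ℝ (e + τ • rot e) u) {t κ : ℝ} (ht : 0 < t) {w : Plane}
    (hw : κ ≤ inner ℝ (rot e) w) (hκ : τ * (‖w‖ + t) ≤ κ) : ‖w + t • (e - u)‖ ≤ ‖w‖ := by
  obtain ⟨h1, -, h3, h4⟩ := inner_cap_bounds he hu hτ h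
  refine (pow_le_pow_iff_left₀ (norm_nonneg _) (norm_nonneg _) two_ne_zero).1 ?_
  set α := inner ℝ e u
  set β := inner ℝ (rot e) u
  have hdec : e - u = (1 - α) • e - β • rot e := by
    have := plane_decomp (v := e) (by rw [← norm_ne_zero_iff, he]; exact one_ne_zero) u
    rw [he, one_pow, div_one, div_one, real_inner_comm, real_inner_comm e u] at this
    rw [this]
    module
  have hnorm : ‖e - u‖ ^ 2 = 2 * (1 - α) := by
    rw [norm_sub_sq_real, he, hu]; ring
  have hew : inner ℝ w e ≤ ‖w‖ := by
    have := real_inner_le_norm w e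
    rwa [he, mul_one] at this
  have hinner : inner ℝ w (e - u) ≤ β * (τ * ‖w‖ - κ) := by
    rw [hdec, inner_sub_right, inner_smul_right, inner_smul_right, real_inner_comm (rot e) w]
    nlinarith [norm_nonneg w, mul_le_mul_of_nonneg_left hew h4,
      mul_le_mul_of_nonneg_right h3 (norm_nonneg w), mul_le_mul_of_nonneg_left hw h1]
  rw [norm_add_sq_real, inner_smul_right, norm_smul, mul_pow, hnorm, Real.norm_of_nonneg ht.le]
  have h5 : t * inner ℝ w (e - u) ≤ t * (β * (τ * ‖w‖ - κ)) :=
    mul_le_mul_of_nonneg_left hinner ht.le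
  have h6 : t ^ 2 * (1 - α) ≤ t ^ 2 * (τ * β) := mul_le_mul_of_nonneg_left h3 (by positivity)
  have h7 : 0 ≤ t * β * (κ - τ * (‖w‖ + t)) := mul_nonneg (by positivity) (by linarith)
  nlinarith

/-- The point of the unit circle with coordinate `s` in the direction `rot e`. -/
noncomputable def arcPoint (e : Plane) (s : ℝ) : Plane := √(1 - s ^ 2) • e + s • rot e

theorem inner_rot_arcPoint {e : Plane} (he : ‖e‖ = 1) (s : ℝ) :
    inner ℝ (rot e) (arcPoint e s) = s := by
  simp [arcPoint, inner_add_right, inner_smul_right, inner_rot_self, norm_rot, he]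

theorem inner_arcPoint {e : Plane} (he : ‖e‖ = 1) (s : ℝ) :
    inner ℝ e (arcPoint e s) = √(1 - s ^ 2) := by
  have h : inner ℝ e (rot e) = 0 := by rw [real_inner_comm, inner_rot_self]
  simp [arcPoint, inner_add_right, inner_smul_right, h, he]

theorem norm_arcPoint {e : Plane} (he : ‖e‖ = 1) {s : ℝ} (hs : s ^ 2 ≤ 1) :
    ‖arcPoint e s‖ = 1 := by
  have h := inner_sq_add_inner_rot_sq he (arcPoint e s)
  rw [inner_rot_arcPoint he, inner_arcPoint he, Real.sq_sqrt (by linarith), sub_add_cancel] at h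
  exact (pow_eq_one_iff_of_nonneg (norm_nonneg _) two_ne_zero).1 h.symm

theorem tendsto_arcPoint (e : Plane) : Tendsto (arcPoint e) (𝓝[>] 0) (𝓝 e) := by
  have : Continuous (arcPoint e) := by unfold arcPoint; fun_prop
  simpa [arcPoint] using (this.tendsto 0).mono_left (nhdsWithin_le_nhds (s := Ioi 0))

theorem exists_injective_unit_near {e : Plane} (he : ‖e‖ = 1) (n : ℕ) {ρ : ℝ} (hρ : 0 < ρ) :
    ∃ f : Fin n → Plane, Function.Injective f ∧ ∀ i, ‖f i‖ = 1 ∧ dist (f i) e < ρ := by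
  have h : ∀ᶠ s in 𝓝[>] (0 : ℝ), dist (arcPoint e s) e < ρ ∧ s < 1 ∧ 0 < s :=
    ((tendsto_arcPoint e).eventually (ball_mem_nhds e hρ)).and (Ioo_mem_nhdsGT one_pos |>
      fun h => by filter_upwards [h] with s hs using ⟨hs.2, hs.1⟩)
  obtain ⟨σ, hσ, hsub⟩ := mem_nhdsGT_iff_exists_Ioo_subset.1 h
  rw [mem_Ioi] at hσ
  -- The shift by `2` keeps every parameter strictly below `σ`, including the one for `i = 0`.
  have hmem : ∀ i : Fin n, σ / (i + 2 : ℝ) ∈ Ioo 0 σ := fun i => by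
    have : (0 : ℝ) ≤ i := Nat.cast_nonneg _
    exact ⟨by positivity, div_lt_self hσ (by linarith)⟩
  refine ⟨fun i => arcPoint e (σ / (i + 2 : ℝ)), fun i j hij => ?_, fun i => ?_⟩
  · have h1 := congrArg (inner ℝ (rot e)) hij
    simp only [inner_rot_arcPoint he] at h1
    rw [div_eq_div_iff (by positivity) (by positivity)] at h1
    have h2 := mul_left_cancel₀ hσ.ne' h1
    have : (i : ℝ) = j := by linarith
    exact Fin.val_injective (by exact_mod_cast this)
  · obtain ⟨h1, h2, h3⟩ := hsub (hmem i)
    exact ⟨norm_arcPoint he (by nlinarith), h1⟩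

/-- Each `s i` is the positive root of `s² + 2 (m i) s = η`, with the common increment `η = R'² -
R²`. The two bounds on `η` give `R' ≤ R + 1` and `s i ≤ τ₀`. -/
theorem exists_forall_spike_length {ι : Type*} [Finite ι] {m : ι → ℝ} {κ R τ₀ : ℝ} (hκ : 0 < κ)
    (hm : ∀ i, κ ≤ m i) (hR : 0 ≤ R) (hτ₀ : 0 < τ₀) :
    ∃ R' : ℝ, R < R' ∧ R' ≤ R + 1 ∧ ∃ s : ι → ℝ, ∀ i, 0 < s i ∧ s i ≤ τ₀ ∧
      R ^ 2 + 2 * s i * m i + s i ^ 2 = R' ^ 2 := by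
  set η := min 1 (2 * κ * τ₀) with hη
  have hη0 : 0 < η := lt_min one_pos (by positivity)
  have hη1 : η ≤ 1 := min_le_left _ _
  have hη2 : η ≤ 2 * κ * τ₀ := min_le_right _ _
  have hR' : √(R ^ 2 + η) ^ 2 = R ^ 2 + η := Real.sq_sqrt (by positivity)
  refine ⟨√(R ^ 2 + η), Real.lt_sqrt_of_sq_lt (by linarith), ?_, fun i => √(m i ^ 2 + η) - m i,
    fun i => ?_⟩
  · rw [Real.sqrt_le_left (by linarith)]
    nlinarith
  · have hmi : 0 < m i := hκ.trans_le (hm i)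
    have hs : √(m i ^ 2 + η) ^ 2 = m i ^ 2 + η := Real.sq_sqrt (by positivity)
    refine ⟨sub_pos.2 (Real.lt_sqrt_of_sq_lt (by linarith)), ?_, ?_⟩
    · rw [sub_le_iff_le_add, Real.sqrt_le_left (by linarith)]
      nlinarith [hm i]
    · rw [hR']
      linear_combination hs

/-- Near `e` the polygon contributes only `y`, while a spike at `f i` shifts it by up to `s i • rot
(f i)`, which points away from `c`. Away from the caps and their opposites the disc contributes `0`,
so nothing else reaches the new radius. -/
theorem exists_mem_manyFarthest_near_of_antipodalSum_subset {P : ConvexBody Plane} {y c e : Plane}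
    (hP : ∀ w ≠ 0, antipodalSum P w ⊆ closedBall c (dist y c)) (he : ‖e‖ = 1)
    (hec : 0 < inner ℝ (rot e) (y - c)) (hPe : ∀ᶠ w in 𝓝 e, antipodalSum P w ⊆ {y}) (n : ℕ)
    {ε : ℝ} (hε : 0 < ε) : ∃ K, dist K P < ε ∧ K ∈ manyFarthest (n + 1) := by
  set R := dist y c with hRdef
  have hR0 : 0 ≤ R := dist_nonneg
  set κ := inner ℝ (rot e) (y - c) / 2 with hκ
  have hκ0 : 0 < κ := half_pos hec
  have hnear : ∀ᶠ w in 𝓝 e, antipodalSum P w ⊆ {y} ∧ κ < inner ℝ (rot w) (y - c) := by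
    refine hPe.and (ContinuousAt.eventually_lt continuousAt_const ?_ (half_lt_self hec))
    exact (continuous_rot.inner continuous_const).continuousAt
  obtain ⟨r, hr0, hr⟩ := Metric.eventually_nhds_iff.1 hnear
  obtain ⟨ρ, hρ0, hρr, hρ4⟩ : ∃ ρ > 0, 2 * ρ ≤ r ∧ ρ ≤ 1 / 4 :=
    ⟨min (r / 2) (1 / 4), by positivity, by linarith [min_le_left (r / 2) (1 / 4)],
      min_le_right _ _⟩
  obtain ⟨f, hf, hfe⟩ := exists_injective_unit_near he (n + 1) hρ0
  obtain ⟨δ, hδ0, hδρ, hδ⟩ := exists_pos_forall_two_mul_lt_dist hf hρ0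
  set t := ε / 4 with ht
  have ht0 : 0 < t := by positivity
  -- The bounds make the caps disjoint arcs within `δ` of the `f i`, keep the spiked disc in the
  -- disc of radius `2`, and supply the hypothesis `τ (‖w‖ + t) ≤ κ` of the cap estimate.
  obtain ⟨τ₀, hτ₀, hτδ, hτ1, hτκ⟩ : ∃ τ₀ > 0, 2 * τ₀ < δ ^ 2 ∧ τ₀ ≤ 1 ∧
      τ₀ * (R + 1 + t) ≤ κ := by
    refine ⟨min (δ ^ 2 / 4) (min 1 (κ / (R + 1 + t))), by positivity, ?_, ?_, ?_⟩
    · have := min_le_left (δ ^ 2 / 4) (min 1 (κ / (R + 1 + t)))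
      nlinarith
    · exact (min_le_right _ _).trans (min_le_left _ _)
    · rw [← le_div_iff₀ (by positivity)]
      exact (min_le_right _ _).trans (min_le_right _ _)
  have hfr : ∀ i, dist (f i) e < r := fun i => by linarith [(hfe i).2]
  obtain ⟨R', hRR', hR'1, s, hs⟩ := exists_forall_spike_length (R := R) hκ0
    (fun i => (hr (hfr i)).2.le) hR0 (mul_pos ht0 hτ₀)
  set τ : Fin (n + 1) → ℝ := fun i => s i / t with hτ
  have hτ0 : ∀ i, 0 < τ i := fun i => div_pos (hs i).1 ht0
  have hττ₀ : ∀ i, τ i ≤ τ₀ := fun i => by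
    rw [hτ, div_le_iff₀ ht0, mul_comm]; exact (hs i).2.1
  have hts : ∀ i, t * τ i = s i := fun i => mul_div_cancel₀ _ ht0.ne'
  set a : Fin (n + 1) → Plane := fun i => f i + τ i • rot (f i) with ha
  have hcap : ∀ u : Plane, ‖u‖ = 1 → ∀ i, 1 ≤ inner ℝ (a i) u → dist u (f i) < δ := by
    intro u hu i hi
    have h1 := norm_sub_sq_le_of_cap (hfe i).1 hu (hτ0 i) hi
    rw [dist_eq_norm]
    refine lt_of_pow_lt_pow_left₀ 2 hδ0.le ?_
    linarith [hττ₀ i]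
  have hcap1 : ∀ u : Plane, ‖u‖ = 1 → ∀ i, 1 ≤ inner ℝ (a i) u →
      ∀ j ≠ i, inner ℝ (a j) u < 1 := by
    intro u hu i hi j hj
    by_contra! h
    have h1 := hcap u hu i hi
    have h2 := hcap u hu j h
    have h3 := dist_triangle_left (f j) (f i) u
    linarith [hδ j i hj]
  have hcap2 : ∀ u : Plane, ‖u‖ = 1 → ∀ i, 1 ≤ inner ℝ (a i) u →
      ∀ j, inner ℝ (a j) (-u) < 1 := by
    intro u hu i hi j
    by_contra! h
    have h1 := hcap u hu i hi
    have h2 := hcap (-u) (by rwa [norm_neg]) j h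
    have h3 := dist_triangle u (f i) e
    have h4 := dist_triangle (-u) (f j) e
    have h5 : ‖(2 : ℝ) • e‖ ≤ dist u e + dist (-u) e := by
      rw [dist_eq_norm, dist_eq_norm, ← norm_neg ((2 : ℝ) • e),
        show -((2 : ℝ) • e) = (u - e) + (-u - e) by module]
      exact norm_add_le _ _
    rw [norm_smul, he] at h5
    norm_num at h5
    linarith [(hfe i).2, (hfe j).2]
  have hPcap : ∀ u : Plane, ‖u‖ = 1 → ∀ i, 1 ≤ inner ℝ (a i) u → antipodalSum P u ⊆ {y} := by
    intro u hu i hi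
    refine (hr ?_).1
    have := dist_triangle u (f i) e
    linarith [hcap u hu i hi, (hfe i).2]
  -- These are the limits of the sums `y + t • (a i - u)` as `u` tends to `f i` inside its cap; the
  -- lengths `s i` put them all at distance `R'` from `c`.
  set x : Fin (n + 1) → Plane := fun i => y + s i • rot (f i) with hx
  have hxc : ∀ i, ‖x i - c‖ = R' := by
    intro i
    refine (pow_left_inj₀ (norm_nonneg _) (hR0.trans hRR'.le) two_ne_zero).1 ?_
    rw [← (hs i).2.2, hx, add_sub_right_comm, norm_add_sq_real, inner_smul_right, norm_smul,
      norm_rot, (hfe i).1, hRdef, dist_eq_norm, Real.norm_of_nonneg (hs i).1.le,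
      real_inner_comm (rot (f i))]
    ring
  have hxe : ∀ i u, y + t • (a i - u) = x i + t • (f i - u) := by
    intro i u
    simp only [hx, ha, ← hts i]
    module
  have hxu : ∀ u : Plane, ‖u‖ = 1 → ∀ i, 1 ≤ inner ℝ (a i) u →
      y + t • (a i - u) ∈ closedBall c R' := by
    intro u hu i hi
    rw [hxe, mem_closedBall, dist_eq_norm, add_sub_right_comm, ← hxc i]
    refine norm_add_smul_sub_le_of_cap (κ := κ) (hfe i).1 hu (hτ0 i) hi ht0 ?_ ?_
    · rw [hx, add_sub_right_comm, inner_add_right, inner_smul_right, real_inner_self_eq_norm_sq]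
      have := mul_nonneg (hs i).1.le (sq_nonneg ‖rot (f i)‖)
      linarith [(hr (hfr i)).2]
    · rw [hxc]
      exact (mul_le_mul (hττ₀ i) (by linarith) (by linarith) hτ₀.le).trans hτκ
  have hy : y ∈ closedBall c R' := mem_closedBall.2 hRR'.le
  set L := capBody a with hL
  have hKcap : ∀ u : Plane, ‖u‖ = 1 → ∀ i, 1 ≤ inner ℝ (a i) u →
      antipodalSum (P + t • L) u ⊆ closedBall c R' := by
    intro u hu i hi z hz
    obtain ⟨p, hp, _, ⟨q, hq, rfl⟩, rfl⟩ := antipodalSum_add_smul_subset P L u ht0 hz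
    obtain rfl : p = y := hPcap u hu i hi hp
    obtain ⟨α, β, hα, hβ, hαβ, rfl⟩ := antipodalSum_capBody_subset_segment hu
      (hcap1 u hu i hi) (hcap2 u hu i hi) hq
    have h1 := convex_closedBall c R' hy (hxu u hu i hi) hα hβ hαβ
    obtain rfl : α = 1 - β := by linarith
    convert h1 using 1
    module
  have hK : ∀ u ∈ sphere (0 : Plane) 1, antipodalSum (P + t • L) u ⊆ closedBall c R' := by
    intro u hu
    have hu1 : ‖u‖ = 1 := by simpa using hu
    by_cases h1 : ∃ i, 1 ≤ inner ℝ (a i) u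
    · obtain ⟨i, hi⟩ := h1
      exact hKcap u hu1 i hi
    by_cases h2 : ∃ i, 1 ≤ inner ℝ (a i) (-u)
    · obtain ⟨i, hi⟩ := h2
      rw [← antipodalSum_neg]
      exact hKcap (-u) (by rwa [norm_neg]) i hi
    push Not at h1 h2
    intro z hz
    obtain ⟨p, hp, _, ⟨q, hq, rfl⟩, rfl⟩ := antipodalSum_add_smul_subset P L u ht0 hz
    obtain rfl : q = 0 := antipodalSum_capBody_subset hu1 h1 h2 hq
    have := hP u (ne_zero_of_mem_unit_sphere ⟨u, hu⟩) hp
    simpa using closedBall_subset_closedBall hRR'.le this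
  refine ⟨P + t • L, ?_, mem_manyFarthest (hR0.trans_lt hRR')
    (fun u hu => antipodalSum_subset_of_sphere hK hu) (y := x) ?_ (fun i => ?_) ?_⟩
  · refine (dist_add_smul_le P L ht0.le (zero_mem_capBody a) zero_le_two fun z hz =>
      norm_le_of_mem_capBody one_le_two (fun i => ?_) hz).trans_lt (by rw [ht]; linarith)
    refine (norm_add_le _ _).trans ?_
    rw [norm_smul, norm_rot, (hfe i).1, Real.norm_of_nonneg (hτ0 i).le]
    linarith [hττ₀ i]
  · intro i j hij
    have h1 : s i • rot (f i) = s j • rot (f j) := add_left_cancel hij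
    have h2 : s i = s j := by
      have := congrArg norm h1
      rwa [norm_smul, norm_smul, norm_rot, norm_rot, (hfe i).1, (hfe j).1, mul_one, mul_one,
        Real.norm_of_nonneg (hs i).1.le, Real.norm_of_nonneg (hs j).1.le] at this
    rw [h2] at h1
    have h3 := smul_right_injective _ (hs j).1.ne' h1
    by_contra hne
    refine rot_ne_zero (sub_ne_zero.2 (hf.ne hne)) ?_
    rw [rot_sub, h3, sub_self]
  · rw [dist_eq_norm, hxc]
  · intro i η hη
    have hev : ∀ᶠ σ in 𝓝[>] (0 : ℝ), dist (arcPoint (f i) σ) (f i) < η / t ∧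
        σ ∈ Ioo 0 (min 1 (τ i)) :=
      ((tendsto_arcPoint (f i)).eventually (ball_mem_nhds _ (by positivity))).and
        (Ioo_mem_nhdsGT (lt_min one_pos (hτ0 i)))
    obtain ⟨σ, hσ, hσ0, hσ1⟩ := hev.exists
    obtain ⟨hσ1, hστ⟩ := lt_min_iff.1 hσ1
    have hu : ‖arcPoint (f i) σ‖ = 1 := norm_arcPoint (hfe i).1 (by nlinarith)
    have hai : 1 < inner ℝ (a i) (arcPoint (f i) σ) := by
      rw [ha, inner_add_left, inner_smul_left, inner_arcPoint (hfe i).1,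
        inner_rot_arcPoint (hfe i).1, conj_trivial]
      -- With `σ < τ i` this gives `√(1 - σ²) + τ i * σ > 1`: the direction lies strictly inside the
      -- cap, where the face is the spike tip alone.
      have h1 : 1 - σ ^ 2 ≤ √(1 - σ ^ 2) := Real.le_sqrt_of_sq_le
        (by nlinarith [mul_nonneg (sq_nonneg σ) (show 0 ≤ 1 - σ ^ 2 by nlinarith)])
      nlinarith
    refine ⟨arcPoint (f i) σ, by rw [← norm_ne_zero_iff, hu]; exact one_ne_zero, fun z hz => ?_⟩
    obtain ⟨p, hp, _, ⟨q, hq, rfl⟩, rfl⟩ := antipodalSum_add_smul_subset P L _ ht0 hz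
    obtain rfl : p = y := hPcap _ hu i hai.le hp
    obtain rfl := antipodalSum_capBody_subset_singleton hu hai (hcap1 _ hu i hai.le)
      (hcap2 _ hu i hai.le) hq
    simp only
    rw [hxe, mem_ball, dist_eq_norm, add_sub_cancel_left, norm_smul, Real.norm_of_nonneg ht0.le,
      ← dist_eq_norm, dist_comm, mul_comm, ← lt_div_iff₀ ht0]
    exact hσ

/-- The directions around which the sum is `y` form an open set stable under nonzero scaling, so one
can tilt away from orthogonality, normalise and choose the sign. -/
theorem exists_unit_inner_rot_pos {P : ConvexBody Plane} {y v u : Plane} (hv : v ≠ 0)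
    (hu : ∀ᶠ w in 𝓝 u, antipodalSum P w ⊆ {y}) :
    ∃ e : Plane, ‖e‖ = 1 ∧ 0 < inner ℝ (rot e) v ∧ ∀ᶠ w in 𝓝 e, antipodalSum P w ⊆ {y} := by
  have hopen : IsOpen {w | ∀ᶠ w' in 𝓝 w, antipodalSum P w' ⊆ {y}} := isOpen_setOfPred_eventually_nhds
  obtain ⟨w, hw, hwv⟩ : ∃ w, (∀ᶠ w' in 𝓝 w, antipodalSum P w' ⊆ {y}) ∧
      inner ℝ (rot w) v ≠ 0 := by
    by_cases h0 : inner ℝ (rot u) v = 0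
    · have hc : Continuous fun s : ℝ => u + s • rot v := by fun_prop
      have h1 : ∀ᶠ s in 𝓝[>] (0 : ℝ), ∀ᶠ w' in 𝓝 (u + s • rot v), antipodalSum P w' ⊆ {y} :=
        nhdsWithin_le_nhds (hc.continuousAt.eventually (hopen.mem_nhds (by simpa using hu)))
      obtain ⟨s, hs, hs0⟩ := (h1.and self_mem_nhdsWithin).exists
      refine ⟨_, hs, ?_⟩
      have hv2 := norm_sq_plane v
      have hvn : 0 < ‖v‖ ^ 2 := by have := norm_pos_iff.2 hv; positivity
      have : inner ℝ (rot (u + s • rot v)) v = inner ℝ (rot u) v - s * ‖v‖ ^ 2 := by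
        rw [inner_plane, inner_plane, hv2]
        simp
        ring
      rw [this, h0, zero_sub]
      exact neg_ne_zero.2 (mul_ne_zero (ne_of_gt hs0) hvn.ne')
    · exact ⟨u, hu, h0⟩
  have hw0 : w ≠ 0 := by
    rintro rfl
    apply hwv
    simp [inner_plane]
  have hn : ‖w‖ ≠ 0 := norm_ne_zero_iff.2 hw0
  have key : ∀ k : ℝ, k ≠ 0 → ∀ᶠ w' in 𝓝 (k • w), antipodalSum P w' ⊆ {y} := by
    intro k hk
    have hc : Tendsto (fun x : Plane => k⁻¹ • x) (𝓝 (k • w)) (𝓝 w) := by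
      simpa only [id, inv_smul_smul₀ hk] using (tendsto_id (x := 𝓝 (k • w))).const_smul k⁻¹
    filter_upwards [hc.eventually hw] with x hx
    rwa [antipodalSum_smul P x (inv_ne_zero hk)] at hx
  have hrot : ∀ k : ℝ, inner ℝ (rot (k • w)) v = k * inner ℝ (rot w) v := by
    intro k
    rw [inner_plane, inner_plane]
    simp
    ring
  rcases hwv.lt_or_gt with h | h
  · refine ⟨(-‖w‖⁻¹) • w, by simp [norm_smul, hn], ?_, key _ (neg_ne_zero.2 (inv_ne_zero hn))⟩
    rw [hrot, neg_mul, neg_pos]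
    exact mul_neg_of_pos_of_neg (by positivity) h
  · refine ⟨‖w‖⁻¹ • w, by simp [norm_smul, hn], ?_, key _ (inv_ne_zero hn)⟩
    rw [hrot]
    positivity

theorem dense_manyFarthest (n : ℕ) : Dense (manyFarthest (n + 1)) := by
  rw [Metric.dense_iff]
  intro K ε hε
  obtain ⟨P, hPK, hP⟩ := exists_polygon_near K (half_pos hε)
  -- All antipodal sums lie in `P + P`, so this choice of centre forces `y ≠ c`.
  obtain ⟨c, hc⟩ : ∃ c, c ∉ P + P := by
    by_contra! h
    exact (P + P).isCompact.ne_univ (eq_univ_of_forall h)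
  obtain ⟨y, u, hy, hu⟩ := hP c
  have hyc : y - c ≠ 0 := by
    intro h0
    rw [sub_eq_zero] at h0
    obtain ⟨x, hx⟩ := antipodalSum_nonempty P u
    obtain rfl : x = y := hu.self_of_nhds hx
    obtain ⟨p, hp, q, hq, hpq⟩ := hx
    exact hc (h0 ▸ ⟨p, hp.1, q, hq.1, hpq⟩)
  obtain ⟨e, he, hec, hPe⟩ := exists_unit_inner_rot_pos hyc hu
  obtain ⟨K', hK'P, hK'⟩ :=
    exists_mem_manyFarthest_near_of_antipodalSum_subset hy he hec hPe n (half_pos hε)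
  refine ⟨K', ?_, hK'⟩
  have := dist_triangle K' P K
  rw [mem_ball]
  linarith

/-- The set of convex bodies in the plane that have infinitely many convexity points is comeager
in the space of all convex bodies in the plane with the Hausdorff metric. -/
theorem theorem2 :
    {K : ConvexBody (EuclideanSpace ℝ (Fin 2)) |
        {z : EuclideanSpace ℝ (Fin 2) | IsConvexityPoint K z}.Infinite} ∈
      residual (ConvexBody (EuclideanSpace ℝ (Fin 2))) := by
  have h : ∀ᶠ K in residual (ConvexBody Plane), ∀ n, K ∈ manyFarthest (n + 1) :=
    eventually_countable_forall.2 fun n =>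
      residual_of_dense_open (isOpen_manyFarthest (n + 1)) (dense_manyFarthest n)
  exact h.mono fun K hK => infinite_of_forall_mem_manyFarthest hK
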